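/- Let $A$ be a (not necessarily unital) C*-algebra. Its Pedersen ideal $\mathrm{Ped}(A)$ is the linear span of the set of all positive $a\in A$ with $a\le a_1+\dots+a_n$ for some positive $a_1,\dots,a_n\in A$ such that for each $j$ there is a positive $e_j\in A$ with $e_ja_j=a_j$. Equip $\mathrm{Ped}(A)$ with the locally convex inductive limit topology of its C*-subalgebras, that is, the finest locally convex vector space topology such that the inclusion $D\to\mathrm{Ped}(A)$ is continuous for every C*-subalgebra $D$ of $A$ with $D\subseteq\mathrm{Ped}(A)$, where $D$ carries the norm topology. A linear functional $\tau\colon\mathrm{Ped}(A)\to\mathbb C$ is a trace if $\tau(xy)=\tau(yx)$, self-adjoint if $\tau(x^*)=\overline{\tau(x)}$ (for all $x,y\in\mathrm{Ped}(A)$), and positive if $\tau(x)\ge 0$ for all $x\in\mathrm{Ped}(A)$ with $x\geq 0$. Let $T_{\mathbb R}(A)$ be the real vector space of continuous self-adjoint traces on $\mathrm{Ped}(A)$, and let $T_+(A)\subseteq T_{\mathbb R}(A)$ be the set of those that are positive. For a bounded self-adjoint functional $\rho$ on a C*-algebra $D$, the Jordan decomposition of $\rho$ is the pair $(\rho^+,\rho^-)$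 of positive functionals on $D$ with $\rho=\rho^+-\rho^-$ and $\|\rho\|=\|\rho^+\|+\|\rho^-\|$. (1) For every $\tau\in T_{\mathbb R}(A)$ there is a unique pair $(\tau^+,\tau^-)$ of positive traces on $\mathrm{Ped}(A)$ such that $\tau=\tau^+-\tau^-$ and, for every hereditary C*-subalgebra $D$ of $A$ with $D\subseteq\mathrm{Ped}(A)$, $(\tau^+|_D,\tau^-|_D)$ is the Jordan decomposition of the bounded functional $\tau|_D$. (2) $T_{\mathbb R}(A)$ with the order $\sigma\le\tau\iff\tau-\sigma\in T_+(A)$ is a real vector lattice (an ordered real vector space in which any two elements have a supremum and an infimum), and $\tau^+=\tau\vee 0$ for every $\tau\in T_{\mathbb R}(A)$. -/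

import Mathlib

open scoped ComplexOrder

namespace PedTrace

universe u

section Conjugation

variable {A : Type u} [NonUnitalCStarAlgebra A]

/-- Conjugation `a ↦ (1 + v) a (1 + v)⋆`, expressed without a unit. -/
def conjBy (v a : A) : A := a + v * a + a * star v + v * a * star v

theorem conjBy_sq (v b : A) :
    conjBy v (star b * b) = star (b + b * star v) * (b + b * star v) := by
  simp only [conjBy, star_add, star_mul, star_star]
  noncomm_ring

theorem conjBy_mul (v : A) (hv : v + star v + star v * v = 0) (a b : A) :
    conjBy v a * conjBy v b = conjBy v (a * b) := by
  have h : star v * v = -(v + star v) := by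
    rw [eq_neg_iff_add_eq_zero, add_comm]; exact hv
  have h2 : ∀ x, star v * (v * x) = -(v * x + star v * x) := by
    intro x; rw [← mul_assoc, h]; noncomm_ring
  simp only [conjBy, mul_add, add_mul, mul_assoc, h2, mul_neg]
  abel

theorem conjBy_sub (v a b : A) : conjBy v (a - b) = conjBy v a - conjBy v b := by
  simp only [conjBy]; noncomm_ring

theorem conjBy_sum (v : A) {n : ℕ} (b : Fin n → A) :
    conjBy v (∑ j, b j) = ∑ j, conjBy v (b j) := by
  simp only [conjBy, Finset.mul_sum, Finset.sum_mul, Finset.sum_add_distrib]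

/-- A self-adjoint contraction `h` is the imaginary part of a unitary `1 + v`. -/
theorem exists_unitary_imag (h : A) (hh : IsSelfAdjoint h) (hn : ‖h‖ ≤ 1) :
    ∃ g : A, IsSelfAdjoint g ∧ g * h = h * g ∧ g + g + g * g + h * h = 0 := by
  let f : ℝ → ℝ := fun t => √(1 - t ^ 2) - 1
  have hf : Continuous f := by fun_prop
  have hf0 : f 0 = 0 := by simp [f]
  have hc : (cfcₙ f h) * h = h * cfcₙ f h := by
    have := (cfcₙ_commute_cfcₙ f (fun x : ℝ => x) h).eq
    rwa [cfcₙ_id' ℝ h] at this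
  refine ⟨cfcₙ f h, cfcₙ_predicate f h, hc, ?_⟩
  have e : cfcₙ f h + cfcₙ f h + cfcₙ f h * cfcₙ f h + h * h
      = cfcₙ (fun t : ℝ => f t + f t + f t * f t + t * t) h := by
    rw [cfcₙ_add (a := h) (fun t : ℝ => f t + f t + f t * f t) (fun t : ℝ => t * t)
      (by fun_prop) (by simp [hf0]) (by fun_prop) (by simp),
      cfcₙ_add (a := h) (fun t : ℝ => f t + f t) (fun t : ℝ => f t * f t)
      (by fun_prop) (by simp [hf0]) (by fun_prop) (by simp [hf0]),
      cfcₙ_add (a := h) f f (by fun_prop) hf0 (by fun_prop) hf0,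
      cfcₙ_mul f f h (by fun_prop) hf0 (by fun_prop) hf0,
      cfcₙ_mul (fun t : ℝ => t) (fun t : ℝ => t) h, cfcₙ_id' ℝ h]
  rw [e]
  have z : cfcₙ (fun t : ℝ => f t + f t + f t * f t + t * t) h
      = cfcₙ (fun _ : ℝ => (0 : ℝ)) h := by
    refine cfcₙ_congr fun t ht => ?_
    have h1 : ‖t‖ ≤ 1 :=
      (NonUnitalIsometricContinuousFunctionalCalculus.norm_quasispectrum_le h ht hh).trans hn
    have h2 : 0 ≤ 1 - t ^ 2 := by
      rw [Real.norm_eq_abs, abs_le] at h1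
      nlinarith
    have h3 := Real.sq_sqrt h2
    simp only [f]
    nlinarith
  rw [z]
  simp

end Conjugation

section Pedersen

variable (A : Type u) [NonUnitalCStarAlgebra A] [PartialOrder A]

/-- The generators of the Pedersen ideal: positive elements `a` for which there is a positive
element `e` with `e * a = a`. -/
def pedZero : Set A := {a | 0 ≤ a ∧ ∃ e : A, 0 ≤ e ∧ e * a = a}

/-- The hereditary cone generated by `pedZero A`: positive elements which are dominated by a
finite sum of elements of `pedZero A`. -/
def pedCone : Set A :=
  {a | 0 ≤ a ∧ ∃ (n : ℕ) (b : Fin n → A), (∀ j, b j ∈ pedZero A) ∧ a ≤ ∑ j, b j}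

variable {A} [StarOrderedRing A]

theorem pedCone_of_le {a b : A} (ha : 0 ≤ a) (hab : a ≤ b) (hb : b ∈ pedCone A) :
    a ∈ pedCone A := by
  obtain ⟨_, n, c, hc, hbc⟩ := hb
  exact ⟨ha, n, c, hc, hab.trans hbc⟩

theorem pedCone_add {a b : A} (ha : a ∈ pedCone A) (hb : b ∈ pedCone A) :
    a + b ∈ pedCone A := by
  obtain ⟨ha0, n, c, hc, hac⟩ := ha
  obtain ⟨hb0, m, d, hd, hbd⟩ := hb
  refine ⟨add_nonneg ha0 hb0, n + m, Fin.append c d, fun j => ?_, ?_⟩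
  · refine Fin.addCases (fun i => ?_) (fun i => ?_) j
    · simpa using hc i
    · simpa using hd i
  · rw [Fin.sum_univ_add]
    simpa using add_le_add hac hbd

theorem pedCone_smul {a : A} (r : ℝ) (hr : 0 ≤ r) (ha : a ∈ pedCone A) :
    r • a ∈ pedCone A := by
  obtain ⟨ha0, n, c, hc, hac⟩ := ha
  refine ⟨smul_nonneg hr ha0, n, fun j => r • c j, fun j => ?_, ?_⟩
  · obtain ⟨h0, e, he, hec⟩ := hc j
    exact ⟨smul_nonneg hr h0, e, he, by rw [mul_smul_comm, hec]⟩
  · rw [← Finset.smul_sum]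
    exact smul_le_smul_of_nonneg_left hac hr

theorem conjBy_nonneg (v : A) {a : A} (ha : 0 ≤ a) : 0 ≤ conjBy v a := by
  obtain ⟨b, rfl⟩ := CStarAlgebra.nonneg_iff_eq_star_mul_self.mp ha
  rw [conjBy_sq]
  exact star_mul_self_nonneg _

theorem pedCone_conjBy (v : A) (hv : v + star v + star v * v = 0) {a : A}
    (ha : a ∈ pedCone A) : conjBy v a ∈ pedCone A := by
  obtain ⟨ha0, n, c, hc, hac⟩ := ha
  refine ⟨conjBy_nonneg v ha0, n, fun j => conjBy v (c j), fun j => ?_, ?_⟩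
  · obtain ⟨h0, e, he, hec⟩ := hc j
    exact ⟨conjBy_nonneg v h0, conjBy v e, conjBy_nonneg v he, by rw [conjBy_mul v hv, hec]⟩
  · rw [← conjBy_sum, ← sub_nonneg, ← conjBy_sub]
    exact conjBy_nonneg v (sub_nonneg.mpr hac)

theorem pedCone_conj_of_contraction (h : A) (hh : IsSelfAdjoint h) (hn : ‖h‖ ≤ 1) {a : A}
    (ha : a ∈ pedCone A) : h * a * h ∈ pedCone A := by
  obtain ⟨g, hg, hgh, hsum⟩ := exists_unitary_imag h hh hn
  set v : A := g + Complex.I • h with hv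
  have hsv : star v = g - Complex.I • h := by
    simp [hv, hg.star_eq, hh.star_eq, sub_eq_add_neg]
  have hI : ∀ x : A, Complex.I • Complex.I • x = -x := fun x => by
    rw [smul_smul, Complex.I_mul_I, neg_one_smul]
  have hsv' : star (g - Complex.I • h) = g + Complex.I • h := by rw [← hsv, star_star, hv]
  have h1 : v + star v + star v * v = 0 := by
    rw [hsv, hv, ← hsum]
    simp only [sub_mul, mul_add, smul_mul_assoc, mul_smul_comm, smul_add, smul_sub, hI, hgh]
    abel
  have h2 : star v + star (star v) + star (star v) * star v = 0 := by
    rw [star_star, hsv, hv, ← hsum]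
    simp only [add_mul, mul_sub, smul_mul_assoc, mul_smul_comm, smul_add, smul_sub, hI, hgh]
    abel
  have key : conjBy v a + conjBy (star v) a = (2 : ℝ) • conjBy g a + (2 : ℝ) • (h * a * h) := by
    rw [hsv]
    simp only [conjBy, hsv', hg.star_eq, two_smul]
    rw [hsv, hv]
    simp only [add_mul, sub_mul, mul_add, mul_sub, smul_mul_assoc, mul_smul_comm, smul_add,
      smul_sub, hI]
    abel
  have m := pedCone_smul (1 / 2 : ℝ) (by norm_num)
    (pedCone_add (pedCone_conjBy v h1 ha) (pedCone_conjBy (star v) h2 ha))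
  rw [key, smul_add, smul_smul, smul_smul] at m
  norm_num at m
  have hpos : 0 ≤ h * a * h := by
    have := star_left_conjugate_nonneg ha.1 h
    rwa [hh.star_eq] at this
  exact pedCone_of_le hpos (le_add_of_nonneg_left (conjBy_nonneg g ha.1)) m

theorem pedCone_conj_selfAdjoint (h : A) (hh : IsSelfAdjoint h) {a : A}
    (ha : a ∈ pedCone A) : h * a * h ∈ pedCone A := by
  set r : ℝ := ‖h‖ + 1
  have hr : 0 < r := by positivity
  have h1 : IsSelfAdjoint (r⁻¹ • h) := (IsSelfAdjoint.all r⁻¹).smul hh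
  have h2 : ‖r⁻¹ • h‖ ≤ 1 := by
    rw [norm_smul, norm_inv, Real.norm_of_nonneg hr.le, inv_mul_le_one₀ hr]
    simp [r]
  have := pedCone_smul (r * r) (by positivity) (pedCone_conj_of_contraction _ h1 h2 ha)
  rw [smul_mul_assoc, smul_mul_assoc, mul_smul_comm, smul_smul, smul_smul] at this
  rwa [show r * r * r⁻¹ * r⁻¹ = 1 by field_simp, one_smul] at this

theorem pedCone_conj (x : A) {a : A} (ha : a ∈ pedCone A) : x * a * star x ∈ pedCone A := by
  obtain ⟨h, k, hh, hk, rfl⟩ : ∃ h k : A, IsSelfAdjoint h ∧ IsSelfAdjoint k ∧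
      x = h + Complex.I • k :=
    ⟨realPart x, imaginaryPart x, (realPart x).2, (imaginaryPart x).2,
      (realPart_add_I_smul_imaginaryPart x).symm⟩
  have hI : ∀ x : A, Complex.I • Complex.I • x = -x := fun x => by
    rw [smul_smul, Complex.I_mul_I, neg_one_smul]
  have hs : star (h + Complex.I • k) = h - Complex.I • k := by
    simp [hh.star_eq, hk.star_eq, sub_eq_add_neg]
  have hs' : star (h - Complex.I • k) = h + Complex.I • k := by rw [← hs, star_star]
  have key : (h + Complex.I • k) * a * (h - Complex.I • k)
      + (h - Complex.I • k) * a * (h + Complex.I • k)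
      = (2 : ℝ) • (h * a * h + k * a * k) := by
    simp only [two_smul, add_mul, sub_mul, mul_add, mul_sub, smul_mul_assoc, mul_smul_comm,
      smul_add, smul_sub, hI]
    abel
  have m := pedCone_smul 2 (by norm_num)
    (pedCone_add (pedCone_conj_selfAdjoint h hh ha) (pedCone_conj_selfAdjoint k hk ha))
  rw [← key] at m
  have p1 := star_right_conjugate_nonneg ha.1 (h + Complex.I • k)
  have p2 := star_right_conjugate_nonneg ha.1 (h - Complex.I • k)
  rw [hs'] at p2
  rw [hs] at p1 ⊢
  exact pedCone_of_le p1 (le_add_of_nonneg_right p2) m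

theorem mul_mem_span_pedCone (x : A) {a : A} (ha : a ∈ pedCone A) :
    x * a ∈ Submodule.span ℂ (pedCone A) := by
  obtain ⟨s, hs, hsa⟩ := CStarAlgebra.nonneg_iff_exists_isSelfAdjoint_and_eq_mul_self.mp ha.1
  obtain ⟨y, hy⟩ : ∃ y : A, y = s * star x := ⟨_, rfl⟩
  have hys : star y = x * s := by simp [hy, hs.star_eq]
  have hI : ∀ x : A, Complex.I • Complex.I • x = -x := fun x => by
    rw [smul_smul, Complex.I_mul_I, neg_one_smul]
  have hb : (2 : ℝ) • (a + x * a * star x) ∈ pedCone A :=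
    pedCone_smul 2 (by norm_num) (pedCone_add ha (pedCone_conj x ha))
  have e1 : star s * s + star y * y = a + x * a * star x := by
    rw [hys, hy, hs.star_eq, hsa]; noncomm_ring
  have mem : ∀ w : ℂ, star w * w = 1 → star (s + w • y) * (s + w • y) ∈ pedCone A := by
    intro w hw
    refine pedCone_of_le (star_mul_self_nonneg _) ?_ hb
    have : (2 : ℝ) • (a + x * a * star x) = star (s + w • y) * (s + w • y)
        + star (s - w • y) * (s - w • y) := by
      rw [← e1, two_smul]
      have hw'' : ∀ z : A, w • star w • z = z := fun z => by
        rw [smul_smul, mul_comm, hw, one_smul]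
      simp only [star_add, star_sub, star_smul, add_mul, sub_mul, mul_add, mul_sub,
        smul_mul_assoc, mul_smul_comm, smul_add, smul_sub, hw'']
      abel
    rw [this]
    exact le_add_of_nonneg_right (star_mul_self_nonneg _)
  have key : x * a = (1 / 4 : ℂ) • (star (s + (1 : ℂ) • y) * (s + (1 : ℂ) • y)
      - star (s + (-1 : ℂ) • y) * (s + (-1 : ℂ) • y)
      + Complex.I • (star (s + Complex.I • y) * (s + Complex.I • y))
      - Complex.I • (star (s + (-Complex.I) • y) * (s + (-Complex.I) • y))) := by
    have e : x * a = star y * s := by rw [hys, hsa, mul_assoc]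
    rw [e, eq_comm, one_div, inv_smul_eq_iff₀ (by norm_num)]
    have h4 : (4 : ℂ) • (star y * s) = star y * s + star y * s + star y * s + star y * s := by
      rw [show (4 : ℂ) = 1 + 1 + 1 + 1 by norm_num]; simp only [add_smul, one_smul]
    rw [h4]
    have hn : ∀ (z : A), (-1 : ℂ) • z = -z := fun z => by rw [neg_one_smul]
    have hnI : ∀ (z : A), (-Complex.I) • z = -(Complex.I • z) := fun z => neg_smul _ _
    simp only [one_smul, hn, hnI, star_add, star_neg, star_smul, RCLike.star_def, Complex.conj_I,
      add_mul, mul_add, neg_mul, mul_neg, smul_mul_assoc, mul_smul_comm, smul_add, smul_neg, hI,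
      neg_neg]
    abel
  rw [key]
  have sp : ∀ w : ℂ, star w * w = 1 →
      star (s + w • y) * (s + w • y) ∈ Submodule.span ℂ (pedCone A) :=
    fun w hw => Submodule.subset_span (mem w hw)
  refine Submodule.smul_mem _ _ (Submodule.sub_mem _ (Submodule.add_mem _ (Submodule.sub_mem _
    (sp _ (by simp)) (sp _ (by simp))) (Submodule.smul_mem _ _ (sp _ (by simp))))
    (Submodule.smul_mem _ _ (sp _ (by simp))))

theorem mul_mem_span_left (x : A) {y : A} (hy : y ∈ Submodule.span ℂ (pedCone A)) :
    x * y ∈ Submodule.span ℂ (pedCone A) := by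
  induction hy using Submodule.span_induction with
  | mem a ha => exact mul_mem_span_pedCone x ha
  | zero => simp
  | add a b _ _ ha hb => rw [mul_add]; exact Submodule.add_mem _ ha hb
  | smul c a _ ha => rw [mul_smul_comm]; exact Submodule.smul_mem _ _ ha

theorem star_mem_span {y : A} (hy : y ∈ Submodule.span ℂ (pedCone A)) :
    star y ∈ Submodule.span ℂ (pedCone A) := by
  induction hy using Submodule.span_induction with
  | mem a ha =>
    rw [(IsSelfAdjoint.of_nonneg ha.1).star_eq]
    exact Submodule.subset_span ha
  | zero => simp
  | add a b _ _ ha hb => rw [star_add]; exact Submodule.add_mem _ ha hb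
  | smul c a _ ha => rw [star_smul]; exact Submodule.smul_mem _ _ ha

variable (A)

/-- The Pedersen ideal `Ped(A)`: the linear span of the hereditary cone generated by the
positive elements `a` such that `e * a = a` for some positive `e`. -/
def Ped : NonUnitalStarSubalgebra ℂ A where
  __ := Submodule.span ℂ (pedCone A)
  mul_mem' := fun {x _} _ hy => mul_mem_span_left x hy
  star_mem' := fun {_} hx => star_mem_span hx

variable {A}

theorem Ped_mul_mem_left (x : A) {y : A} (hy : y ∈ Ped A) : x * y ∈ Ped A :=
  mul_mem_span_left x hy

theorem Ped_mul_mem_right (x : A) {y : A} (hy : y ∈ Ped A) : y * x ∈ Ped A := by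
  have := star_mem_span (mul_mem_span_left (star x) (star_mem_span hy))
  rwa [star_mul, star_star, star_star] at this

variable (A)

/-- The locally convex inductive limit topology on `Ped(A) = ⋃ D`, where `D` ranges over the
C⋆-subalgebras of `A` contained in `Ped(A)`: the finest locally convex vector space topology for
which every inclusion `D → Ped(A)` is continuous, where `D` carries its norm topology. (In
Mathlib's order on topologies, `sInf` is the coarsest common refinement.) This is not the
subspace topology of `Ped(A)` in `A`. -/
@[reducible]
def pedTopology : TopologicalSpace (Ped A) :=
  sInf {t : TopologicalSpace (Ped A) |
    @IsTopologicalAddGroup (Ped A) t _ ∧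
    @ContinuousSMul ℂ (Ped A) _ _ t ∧
    @LocallyConvexSpace ℝ (Ped A) _ _ _ _ t ∧
    ∀ (D : NonUnitalStarSubalgebra ℂ A) (_ : IsClosed (D : Set A)) (hD : D ≤ Ped A),
      @Continuous D (Ped A) _ t (NonUnitalStarSubalgebra.inclusion hD)}

variable {A}

/-- A linear functional on `Ped(A)` is positive if it maps positive elements to `[0, ∞)`. -/
def IsPositive (τ : Ped A →ₗ[ℂ] ℂ) : Prop := ∀ x : Ped A, 0 ≤ (x : A) → 0 ≤ τ x

/-- A linear functional on `Ped(A)` is tracial (a trace). -/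
def IsTracial (τ : Ped A →ₗ[ℂ] ℂ) : Prop := ∀ x y : Ped A, τ (x * y) = τ (y * x)

/-- A linear functional on `Ped(A)` is self-adjoint. -/
def IsSelfAdj (τ : Ped A →ₗ[ℂ] ℂ) : Prop := ∀ x : Ped A, τ (star x) = star (τ x)

variable (A)

/-- `T_ℝ(A)`: the real vector space of continuous self-adjoint traces on `Ped(A)`. -/
def TR : Submodule ℝ (Ped A →ₗ[ℂ] ℂ) where
  carrier := {τ | @Continuous (Ped A) ℂ (pedTopology A) _ τ ∧ IsSelfAdj τ ∧ IsTracial τ}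
  zero_mem' := ⟨@continuous_const _ _ (pedTopology A) _ 0, fun x => by simp, fun x y => by simp⟩
  add_mem' := by
    rintro σ τ ⟨h1, h2, h3⟩ ⟨k1, k2, k3⟩
    refine ⟨?_, fun x => ?_, fun x y => ?_⟩
    · let _ := pedTopology A
      exact h1.add k1
    · simp only [LinearMap.add_apply, h2 x, k2 x, star_add]
    · simp only [LinearMap.add_apply, h3 x y, k3 x y]
  smul_mem' := by
    rintro r τ ⟨h1, h2, h3⟩
    refine ⟨?_, fun x => ?_, fun x y => ?_⟩
    · let _ := pedTopology A
      exact h1.const_smul r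
    · simp only [LinearMap.smul_apply, h2 x, star_smul, star_trivial]
    · simp only [LinearMap.smul_apply, h3 x y]

/-- `T_+(A)`: the cone of positive traces in `T_ℝ(A)`. -/
def TPlus : Set (TR A) := {τ | IsPositive (τ : Ped A →ₗ[ℂ] ℂ)}

end Pedersen

section Jordan

/-- `(ρ₁, ρ₂)` is the Jordan decomposition of the bounded functional `ρ` on a C⋆-algebra `D`:
`ρ₁` and `ρ₂` are positive, `ρ = ρ₁ - ρ₂` and `‖ρ‖ = ‖ρ₁‖ + ‖ρ₂‖`. -/
structure IsJordanDecomposition {D : Type u} [NonUnitalCStarAlgebra D] [PartialOrder D]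
    (ρ ρ₁ ρ₂ : D →L[ℂ] ℂ) : Prop where
  nonneg_left : ∀ x : D, 0 ≤ x → 0 ≤ ρ₁ x
  nonneg_right : ∀ x : D, 0 ≤ x → 0 ≤ ρ₂ x
  eq_sub : ρ = ρ₁ - ρ₂
  norm_eq : ‖ρ‖ = ‖ρ₁‖ + ‖ρ₂‖

variable {A : Type u} [NonUnitalCStarAlgebra A] [PartialOrder A] [StarOrderedRing A]

/-- `D` is a hereditary C⋆-subalgebra of `A`: a norm-closed star subalgebra such that `0 ≤ a ≤ b`
and `b ∈ D` imply `a ∈ D`. -/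
structure IsHereditary (D : NonUnitalStarSubalgebra ℂ A) : Prop where
  isClosed : IsClosed (D : Set A)
  mem_of_le : ∀ a b : A, 0 ≤ a → a ≤ b → b ∈ D → a ∈ D

/-- The bounded functional `ρ` on the C⋆-subalgebra `D ⊆ Ped(A)` is the restriction of `τ`. -/
def IsRestriction (τ : Ped A →ₗ[ℂ] ℂ) {D : NonUnitalStarSubalgebra ℂ A} (hD : D ≤ Ped A)
    (ρ : D →L[ℂ] ℂ) : Prop :=
  ∀ x : D, ρ x = τ (NonUnitalStarSubalgebra.inclusion hD x)

/-- `(τ₁, τ₂)` is a Jordan decomposition of the functional `τ` on `Ped(A)`: `τ₁` and `τ₂` are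
positive traces on `Ped(A)`, `τ = τ₁ - τ₂`, and for every hereditary C⋆-subalgebra `D ⊆ Ped(A)`
the restrictions of `τ`, `τ₁`, `τ₂` to `D` are bounded and `(τ₁|_D, τ₂|_D)` is the Jordan
decomposition of `τ|_D`. -/
structure IsPedJordanDecomposition (τ τ₁ τ₂ : Ped A →ₗ[ℂ] ℂ) : Prop where
  positive_left : IsPositive τ₁
  positive_right : IsPositive τ₂
  tracial_left : IsTracial τ₁
  tracial_right : IsTracial τ₂
  eq_sub : τ = τ₁ - τ₂
  restrict : ∀ (D : NonUnitalStarSubalgebra ℂ A) (hH : IsHereditary D) (hD : D ≤ Ped A),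
    haveI : IsClosed (D : Set A) := hH.isClosed
    ∃ ρ ρ₁ ρ₂ : D →L[ℂ] ℂ, IsRestriction τ hD ρ ∧ IsRestriction τ₁ hD ρ₁ ∧
      IsRestriction τ₂ hD ρ₂ ∧ IsJordanDecomposition ρ ρ₁ ρ₂

end Jordan

end PedTrace

/-! For positive `a` in `Ped A` put `τ⁺(a) = sup {τ(b) : 0 ≤ b ≤ a}`. The supremum is finite because
the hereditary subalgebra `her a` contains the interval `[0, a]` and lies in `Ped A` (`her_le_Ped`),
and `τ` is bounded on every C⋆-subalgebra of `Ped A`.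

Additivity and the trace property of `τ⁺` both come from a noncommutative Riesz decomposition
(`exists_riesz_decomposition`): if `0 ≤ b ≤ ∑ yᵢ yᵢ⋆`, then `b = ∑ zᵢ zᵢ⋆` with `zᵢ⋆ zᵢ ≤ yᵢ⋆ yᵢ`.
As `τ` is a trace, `τ(b) = ∑ τ(zᵢ⋆ zᵢ) ≤ ∑ τ⁺(yᵢ⋆ yᵢ)`. Two terms `√a`, `√b` give subadditivity; a
single term `y` gives `τ⁺(y y⋆) ≤ τ⁺(y⋆ y)`. The `zᵢ` are limits of `√b · √x (ε + x)⁻¹ · yᵢ`, where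
`x = ∑ yᵢ yᵢ⋆`. The same limits prove `her_le_Ped`.

So `τ⁺` extends to a positive trace, and `τ⁻ = τ⁺ - τ` is positive too. On a hereditary subalgebra
`D`, intervals of `D` agree with intervals of `A`, so `τ⁺` is still a supremum over intervals there.
This forces the norm identity (`isJordanDecomposition_of_approx`) and uniqueness on `D`
(`IsJordanDecomposition.eq_of_approx`). Evaluating on `her x` at `x` gives uniqueness on `Ped A`.
Finally `τ⁺` is the least positive functional above `τ`, so `τ⁺ = τ ⊔ 0`, and translation yields `σ
⊔ τ = τ + (σ - τ)⁺` and `σ ⊓ τ = σ - (σ - τ)⁺`. -/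

namespace PedTrace

universe u

set_option linter.unusedSectionVars false

/-! ### Approximate units, approximate inverse roots and hereditary subalgebras. -/

section ApproximateRoots

open Filter Topology

variable {A : Type u} [NonUnitalCStarAlgebra A] [PartialOrder A] [StarOrderedRing A]

/-- The elements `x / (1 / (n + 1) + x)`, an approximate unit for the hereditary subalgebra
generated by the positive element `x`. -/
noncomputable def unitApprox (x : A) (n : ℕ) : A :=
  cfcₙ (fun t : ℝ => |t| / (1 / ((n : ℝ) + 1) + |t|)) x

/-- The elements `√x / (1 / (n + 1) + x)`, approximate inverses of `√x`. -/
noncomputable def rootApprox (x : A) (n : ℕ) : A :=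
  cfcₙ (fun t : ℝ => √t / (1 / ((n : ℝ) + 1) + |t|)) x

theorem denom_pos (n : ℕ) (t : ℝ) : 0 < 1 / ((n : ℝ) + 1) + |t| := by positivity

theorem continuous_unitApprox_fun (n : ℕ) :
    Continuous (fun t : ℝ => |t| / (1 / ((n : ℝ) + 1) + |t|)) :=
  continuous_abs.div (by fun_prop) fun t => (denom_pos n t).ne'

theorem continuous_rootApprox_fun (n : ℕ) :
    Continuous (fun t : ℝ => √t / (1 / ((n : ℝ) + 1) + |t|)) :=
  Real.continuous_sqrt.div (by fun_prop) fun t => (denom_pos n t).ne'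

theorem isSelfAdjoint_unitApprox (x : A) (n : ℕ) : IsSelfAdjoint (unitApprox x n) :=
  cfcₙ_predicate _ x

theorem isSelfAdjoint_rootApprox (x : A) (n : ℕ) : IsSelfAdjoint (rootApprox x n) :=
  cfcₙ_predicate _ x

theorem norm_unitApprox_le (x : A) (n : ℕ) : ‖unitApprox x n‖ ≤ 1 := by
  refine norm_cfcₙ_le fun t _ => ?_
  have h := denom_pos n t
  rw [Real.norm_eq_abs, abs_of_nonneg (by positivity), div_le_one h]
  have : 0 < 1 / ((n : ℝ) + 1) := by positivity
  linarith

theorem rootApprox_mul_sqrt {x : A} (hx : 0 ≤ x) (n : ℕ) :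
    rootApprox x n * CFC.sqrt x = unitApprox x n := by
  rw [CFC.sqrt_eq_real_sqrt x hx, rootApprox, unitApprox,
    ← cfcₙ_mul _ _ x (continuous_rootApprox_fun n).continuousOn (by simp)
      Real.continuous_sqrt.continuousOn (by simp)]
  refine cfcₙ_congr fun t ht => ?_
  have ht0 := quasispectrum_nonneg_of_nonneg x hx t ht
  simp only [abs_of_nonneg ht0]
  rw [div_mul_eq_mul_div, Real.mul_self_sqrt ht0]

/-- With `ε = 1 / (n + 1)` and `q = unitApprox x n`, the element `(1 - q) x (1 - q)` is the function
`t ε² / (ε + t)² ≤ ε` of `x`. -/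
theorem norm_conjBy_neg_unitApprox_le {x : A} (hx : 0 ≤ x) (n : ℕ) :
    ‖conjBy (-unitApprox x n) x‖ ≤ 1 / ((n : ℝ) + 1) := by
  set q : ℝ → ℝ := fun t => |t| / (1 / ((n : ℝ) + 1) + |t|) with hq
  have hqc : Continuous q := continuous_unitApprox_fun n
  have hq0 : q 0 = 0 := by simp [q]
  have e : conjBy (-unitApprox x n) x = cfcₙ (fun t : ℝ => t - q t * t - t * q t + q t * t * q t) x := by
    rw [cfcₙ_add (a := x) (fun t : ℝ => t - q t * t - t * q t) (fun t : ℝ => q t * t * q t)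
      (by fun_prop) (by simp) (by fun_prop) (by simp),
      cfcₙ_sub (a := x) (fun t : ℝ => t - q t * t) (fun t : ℝ => t * q t)
      (by fun_prop) (by simp) (by fun_prop) (by simp),
      cfcₙ_sub (a := x) (fun t : ℝ => t) (fun t : ℝ => q t * t)
      (by fun_prop) (by simp) (by fun_prop) (by simp),
      cfcₙ_mul (fun t : ℝ => q t * t) q x (by fun_prop) (by simp) (by fun_prop) hq0,
      cfcₙ_mul q (fun t : ℝ => t) x (by fun_prop) hq0,
      cfcₙ_mul (fun t : ℝ => t) q x (by fun_prop) rfl (by fun_prop) hq0, cfcₙ_id' ℝ x]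
    have : cfcₙ q x = unitApprox x n := rfl
    rw [this]
    simp only [conjBy, star_neg, (isSelfAdjoint_unitApprox x n).star_eq]
    noncomm_ring
  rw [e]
  refine norm_cfcₙ_le fun t ht => ?_
  have ht0 := quasispectrum_nonneg_of_nonneg x hx t ht
  have hε : 0 < 1 / ((n : ℝ) + 1) := by positivity
  simp only [hq, abs_of_nonneg ht0]
  set ε := 1 / ((n : ℝ) + 1)
  have hd : 0 < ε + t := by positivity
  have : t - t / (ε + t) * t - t * (t / (ε + t)) + t / (ε + t) * t * (t / (ε + t))
      = (t / (ε + t)) * (ε / (ε + t)) * ε := by field_simp; ring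
  rw [this, Real.norm_eq_abs, abs_of_nonneg (by positivity)]
  have h1 : t / (ε + t) ≤ 1 := (div_le_one hd).2 (by linarith)
  have h2 : ε / (ε + t) ≤ 1 := (div_le_one hd).2 (by linarith)
  calc _ ≤ 1 * 1 * ε := by gcongr
    _ = ε := by ring

theorem conjBy_mono (v : A) {a b : A} (hab : a ≤ b) : conjBy v a ≤ conjBy v b := by
  rw [← sub_nonneg, ← conjBy_sub]
  exact conjBy_nonneg v (sub_nonneg.mpr hab)

theorem norm_sub_mul_sq (w q : A) (hq : IsSelfAdjoint q) :
    ‖w - w * q‖ ^ 2 = ‖conjBy (-q) (star w * w)‖ := by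
  rw [sq, ← CStarRing.norm_star_mul_self, conjBy_sq]
  simp [hq.star_eq, sub_eq_add_neg]

/-- The elements on which `unitApprox x` acts as a right approximate unit. -/
def RightUnital (x w : A) : Prop := Tendsto (fun n => w * unitApprox x n) atTop (𝓝 w)

/-- By the C⋆-identity, `‖w (1 - q)‖² = ‖(1 - q) w⋆ w (1 - q)‖ ≤ ‖(1 - q) x (1 - q)‖`, which tends
to zero. -/
theorem rightUnital_of_le {x w : A} (hx : 0 ≤ x) (hw : star w * w ≤ x) : RightUnital x w := by
  rw [RightUnital, tendsto_iff_norm_sub_tendsto_zero]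
  have h1 : Tendsto (fun n : ℕ => √(1 / ((n : ℝ) + 1))) atTop (𝓝 0) := by
    simpa only [Real.sqrt_zero, Function.comp_def] using
      (Real.continuous_sqrt.tendsto 0).comp tendsto_one_div_add_atTop_nhds_zero_nat
  refine squeeze_zero (fun _ => norm_nonneg _) (fun n => ?_) h1
  rw [norm_sub_rev]
  refine Real.le_sqrt_of_sq_le ?_
  rw [norm_sub_mul_sq _ _ (isSelfAdjoint_unitApprox x n)]
  refine (CStarAlgebra.norm_le_norm_of_nonneg_of_le
    (conjBy_nonneg _ (star_mul_self_nonneg w)) (conjBy_mono _ hw)).trans ?_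
  exact norm_conjBy_neg_unitApprox_le hx n

theorem RightUnital.mul_left {x w : A} (hw : RightUnital x w) (v : A) : RightUnital x (v * w) := by
  simpa only [RightUnital, mul_assoc] using hw.const_mul v

/-- This is what makes `her x` hereditary: `‖√b (1 - q)‖² ≤ ‖(1 - q) c (1 - q)‖ ≤ 2 ‖c q - c‖`. -/
theorem RightUnital.sqrt_of_le {x b c : A} (hb : 0 ≤ b) (hbc : b ≤ c)
    (hc : RightUnital x c) : RightUnital x (CFC.sqrt b) := by
  rw [RightUnital, tendsto_iff_norm_sub_tendsto_zero]
  have h1 : Tendsto (fun n : ℕ => √(2 * ‖c * unitApprox x n - c‖)) atTop (𝓝 0) := by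
    have h := (tendsto_iff_norm_sub_tendsto_zero.1 hc).const_mul 2
    rw [mul_zero] at h
    simpa only [Real.sqrt_zero, Function.comp_def] using (Real.continuous_sqrt.tendsto 0).comp h
  refine squeeze_zero (fun _ => norm_nonneg _) (fun n => ?_) h1
  rw [norm_sub_rev]
  refine Real.le_sqrt_of_sq_le ?_
  have hq := isSelfAdjoint_unitApprox x n
  have hs : star (CFC.sqrt b) * CFC.sqrt b = b := by
    rw [(CFC.sqrt_nonneg b).isSelfAdjoint.star_eq, CFC.sqrt_mul_sqrt_self b hb]
  rw [norm_sub_mul_sq _ _ hq, hs]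
  refine (CStarAlgebra.norm_le_norm_of_nonneg_of_le
    (conjBy_nonneg _ hb) (conjBy_mono _ hbc)).trans ?_
  have e : conjBy (-unitApprox x n) c
      = unitApprox x n * (c * unitApprox x n - c) - (c * unitApprox x n - c) := by
    simp only [conjBy, star_neg, hq.star_eq]
    noncomm_ring
  rw [e, two_mul]
  refine (norm_sub_le _ _).trans ?_
  gcongr
  refine (norm_mul_le _ _).trans ?_
  exact mul_le_of_le_one_left (norm_nonneg _) (norm_unitApprox_le x n)

theorem isClosed_rightUnital (x : A) : IsClosed {w : A | RightUnital x w} := by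
  refine isClosed_of_closure_subset fun w hw => ?_
  rw [Set.mem_ofPred_eq, RightUnital, Metric.tendsto_atTop]
  intro ε hε
  obtain ⟨v, hv, hd⟩ := Metric.mem_closure_iff.1 hw (ε / 3) (by positivity)
  obtain ⟨N, hN⟩ := Metric.tendsto_atTop.1 hv (ε / 3) (by positivity)
  refine ⟨N, fun n hn => ?_⟩
  have h1 : ‖(w - v) * unitApprox x n‖ < ε / 3 := by
    refine lt_of_le_of_lt (norm_mul_le _ _) (lt_of_le_of_lt ?_ (dist_eq_norm w v ▸ hd))
    exact mul_le_of_le_one_right (norm_nonneg _) (norm_unitApprox_le x n)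
  have h2 := hN n hn
  rw [dist_eq_norm] at h2 hd ⊢
  have e : w * unitApprox x n - w
      = (w - v) * unitApprox x n + (v * unitApprox x n - v) - (w - v) := by noncomm_ring
  rw [e]
  have := norm_sub_le ((w - v) * unitApprox x n + (v * unitApprox x n - v)) (w - v)
  have := norm_add_le ((w - v) * unitApprox x n) (v * unitApprox x n - v)
  linarith

/-- The hereditary C⋆-subalgebra generated by the positive element `x`. -/
def her (x : A) : NonUnitalStarSubalgebra ℂ A where
  carrier := {y | RightUnital x y ∧ RightUnital x (star y)}
  zero_mem' := by simp [RightUnital]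
  add_mem' := by
    rintro a b ⟨ha, ha'⟩ ⟨hb, hb'⟩
    constructor
    · simpa only [RightUnital, add_mul] using ha.add hb
    · simpa only [RightUnital, add_mul, star_add] using ha'.add hb'
  mul_mem' := by
    rintro a b ⟨ha, ha'⟩ ⟨hb, hb'⟩
    exact ⟨hb.mul_left a, by rw [star_mul]; exact ha'.mul_left _⟩
  smul_mem' := by
    rintro c a ⟨ha, ha'⟩
    constructor
    · simpa only [RightUnital, smul_mul_assoc] using ha.const_smul c
    · simpa only [RightUnital, smul_mul_assoc, star_smul] using ha'.const_smul (star c)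
  star_mem' := by
    rintro a ⟨ha, ha'⟩
    exact ⟨ha', by rwa [star_star]⟩

theorem isHereditary_her (x : A) : IsHereditary (her x) where
  isClosed := (isClosed_rightUnital x).inter ((isClosed_rightUnital x).preimage continuous_star)
  mem_of_le a b ha hab hb := by
    have h : RightUnital x a := by
      have := (RightUnital.sqrt_of_le ha hab hb.1).mul_left (CFC.sqrt a)
      rwa [CFC.sqrt_mul_sqrt_self a ha] at this
    exact ⟨h, by rwa [ha.isSelfAdjoint.star_eq]⟩

theorem self_mem_her {x : A} (hx : 0 ≤ x) : x ∈ her x := by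
  have hs := (CFC.sqrt_nonneg x).isSelfAdjoint
  have h : RightUnital x (CFC.sqrt x) := rightUnital_of_le hx <| by
    rw [hs.star_eq, CFC.sqrt_mul_sqrt_self x hx]
  have := h.mul_left (CFC.sqrt x)
  rw [CFC.sqrt_mul_sqrt_self x hx] at this
  exact ⟨this, by rwa [hx.isSelfAdjoint.star_eq]⟩

theorem sqrt_mem_of_isClosed {D : NonUnitalStarSubalgebra ℂ A} (hD : IsClosed (D : Set A)) {b : A}
    (hb : 0 ≤ b) (hbD : b ∈ D) : CFC.sqrt b ∈ D := by
  rw [CFC.sqrt_eq_real_sqrt b hb]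
  exact cfcₙ_mem (𝕜' := ℂ) Real.sqrt hbD

theorem norm_mul_sq_le (w y x : A) (hy : y * star y ≤ x) (hx : 0 ≤ x) :
    ‖w * y‖ ≤ ‖w * CFC.sqrt x‖ := by
  refine le_of_sq_le_sq ?_ (norm_nonneg _)
  have hs := (CFC.sqrt_nonneg x).isSelfAdjoint
  have e1 : w * y * star (w * y) = w * (y * star y) * star w := by
    simp only [star_mul, mul_assoc]
  have e2 : w * CFC.sqrt x * star (w * CFC.sqrt x) = w * x * star w := by
    conv_rhs => rw [← CFC.sqrt_mul_sqrt_self x hx]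
    simp only [star_mul, mul_assoc, hs.star_eq]
  rw [sq, sq, ← CStarRing.norm_self_mul_star, ← CStarRing.norm_self_mul_star, e1, e2]
  refine CStarAlgebra.norm_le_norm_of_nonneg_of_le ?_ (star_right_conjugate_le_conjugate hy w)
  exact star_right_conjugate_nonneg (mul_star_self_nonneg y) w

/-- If `y y⋆ ≤ x`, then `w √x⁻¹ y` makes sense as a limit. -/
theorem exists_tendsto_mul_rootApprox {x w y : A} (hx : 0 ≤ x) (hw : RightUnital x w)
    (hy : y * star y ≤ x) :
    ∃ z, Tendsto (fun n => w * rootApprox x n * y) atTop (𝓝 z) := by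
  refine cauchySeq_tendsto_of_complete ?_
  refine Metric.cauchySeq_iff.2 fun ε hε => ?_
  obtain ⟨N, hN⟩ := Metric.cauchySeq_iff.1 hw.cauchySeq ε hε
  refine ⟨N, fun m hm n hn => lt_of_le_of_lt ?_ (hN m hm n hn)⟩
  -- Since `y y⋆ ≤ x`, replacing `y` by `√x` only increases the norm, and `rootApprox x n * √x =
  -- unitApprox x n` reduces the estimate to the Cauchy sequence `w * unitApprox x n`.
  rw [dist_eq_norm, dist_eq_norm, ← sub_mul, ← mul_sub, ← mul_sub]
  refine (norm_mul_sq_le _ y x hy hx).trans_eq ?_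
  rw [mul_assoc, sub_mul, rootApprox_mul_sqrt hx, rootApprox_mul_sqrt hx]

theorem rootApprox_conj {x : A} (hx : 0 ≤ x) (n : ℕ) :
    rootApprox x n * x * rootApprox x n = unitApprox x n * unitApprox x n := by
  have h := rootApprox_mul_sqrt hx n
  have h' : CFC.sqrt x * rootApprox x n = unitApprox x n := by
    have := congrArg star h
    rwa [star_mul, (CFC.sqrt_nonneg x).isSelfAdjoint.star_eq,
      (isSelfAdjoint_rootApprox x n).star_eq, (isSelfAdjoint_unitApprox x n).star_eq] at this
  calc _ = rootApprox x n * (CFC.sqrt x * CFC.sqrt x) * rootApprox x n := by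
        rw [CFC.sqrt_mul_sqrt_self x hx]
    _ = (rootApprox x n * CFC.sqrt x) * (CFC.sqrt x * rootApprox x n) := by noncomm_ring
    _ = _ := by rw [h, h']

theorem tendsto_mul_star {ι : Type*} {f : ι → A} {l : Filter ι} {z : A} (h : Tendsto f l (𝓝 z)) :
    Tendsto (fun n => f n * star (f n)) l (𝓝 (z * star z)) := h.mul h.star

/-- The Riesz decomposition: if `∑ yᵢ yᵢ⋆ = x` and `w` lies in the closed left ideal generated by
`x`, then `w w⋆ = ∑ zᵢ zᵢ⋆` for the limits `zᵢ` of `w √x⁻¹ yᵢ`. -/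
theorem sum_mul_star_of_tendsto {ι : Type*} {s : Finset ι} {x w : A} {y z : ι → A} (hx : 0 ≤ x)
    (hw : RightUnital x w) (hy : ∑ i ∈ s, y i * star (y i) = x)
    (hz : ∀ i ∈ s, Tendsto (fun n => w * rootApprox x n * y i) atTop (𝓝 (z i))) :
    ∑ i ∈ s, z i * star (z i) = w * star w := by
  refine tendsto_nhds_unique (tendsto_finsetSum s fun i hi => tendsto_mul_star (hz i hi)) ?_
  refine (tendsto_mul_star hw).congr fun n => ?_
  have : ∀ i ∈ s, w * rootApprox x n * y i * star (w * rootApprox x n * y i)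
      = w * rootApprox x n * (y i * star (y i)) * (rootApprox x n * star w) := by
    intro i _
    simp only [star_mul, (isSelfAdjoint_rootApprox x n).star_eq, mul_assoc]
  rw [Finset.sum_congr rfl this, ← Finset.sum_mul, ← Finset.mul_sum, hy]
  rw [star_mul, (isSelfAdjoint_unitApprox x n).star_eq]
  have e := rootApprox_conj hx n
  calc _ = w * (unitApprox x n * unitApprox x n) * star w := by noncomm_ring
    _ = w * (rootApprox x n * x * rootApprox x n) * star w := by rw [e]
    _ = _ := by noncomm_ring

/-- For `r = rootApprox x n` and `q = unitApprox x n`, each approximant satisfies `y⋆ r (w⋆ w) r y ≤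
y⋆ r x r y = y⋆ q² y ≤ y⋆ y`; the order is closed under limits. -/
theorem star_mul_self_le_of_tendsto {x w y z : A} (hx : 0 ≤ x) (hw : star w * w ≤ x)
    (hz : Tendsto (fun n => w * rootApprox x n * y) atTop (𝓝 z)) : star z * z ≤ star y * y := by
  refine le_of_tendsto (hz.star.mul hz) (Eventually.of_forall fun n => ?_)
  have hr := isSelfAdjoint_rootApprox x n
  have hq := isSelfAdjoint_unitApprox x n
  have e1 : star (w * rootApprox x n * y) * (w * rootApprox x n * y)
      = star (rootApprox x n * y) * (star w * w) * (rootApprox x n * y) := by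
    simp only [star_mul, mul_assoc]
  have e2 : star (rootApprox x n * y) * x * (rootApprox x n * y)
      = star y * (unitApprox x n * unitApprox x n) * y := by
    rw [← rootApprox_conj hx n]
    simp only [star_mul, mul_assoc, hr.star_eq]
  rw [e1]
  refine (star_left_conjugate_le_conjugate hw _).trans ?_
  rw [e2]
  have hsa : IsSelfAdjoint (unitApprox x n * unitApprox x n) := by
    have := IsSelfAdjoint.star_mul_self (unitApprox x n); rwa [hq.star_eq] at this
  refine (CStarAlgebra.star_left_conjugate_le_norm_smul hsa).trans ?_
  have h1 : ‖unitApprox x n * unitApprox x n‖ ≤ 1 :=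
    (norm_mul_le _ _).trans (mul_le_one₀ (norm_unitApprox_le x n) (norm_nonneg _)
      (norm_unitApprox_le x n))
  exact (smul_le_smul_of_nonneg_right h1 (star_mul_self_nonneg y)).trans_eq (one_smul _ _)

end ApproximateRoots

/-! ### Hereditary subalgebras inside the Pedersen ideal, and its positive cone. -/

section PedersenIdeal

open Filter Topology

variable {A : Type u} [NonUnitalCStarAlgebra A] [PartialOrder A] [StarOrderedRing A]

/-- Square roots of positive elements stay in a closed subalgebra, so the order inherited from `A`
is the intrinsic one and C⋆-algebra results apply to `D`. -/
theorem starOrderedRing_of_isClosed {D : NonUnitalStarSubalgebra ℂ A}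
    (hD : IsClosed (D : Set A)) : StarOrderedRing D := by
  refine StarOrderedRing.of_nonneg_iff' (fun {x y} h z => ?_) fun x => ⟨fun h => ?_, ?_⟩
  · exact add_le_add_right (α := A) h z
  · have hx : (0 : A) ≤ x := h
    refine ⟨⟨CFC.sqrt (x : A), sqrt_mem_of_isClosed hD hx x.2⟩, Subtype.ext ?_⟩
    change (x : A) = star (CFC.sqrt (x : A)) * CFC.sqrt (x : A)
    rw [(CFC.sqrt_nonneg (x : A)).isSelfAdjoint.star_eq, CFC.sqrt_mul_sqrt_self _ hx]
  · rintro ⟨s, rfl⟩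
    exact star_mul_self_nonneg (s : A)

theorem subset_Ped {a : A} (ha : a ∈ pedCone A) : a ∈ Ped A := Submodule.subset_span ha

theorem pedZero_subset_pedCone {a : A} (ha : a ∈ pedZero A) : a ∈ pedCone A :=
  ⟨ha.1, 1, fun _ => a, fun _ => ha, by simp⟩

/-- The given `e` need not lie in `Ped A`; a cut-off `φ(e)` does. Where `φ` is nonzero `ψ` equals
one, so `ψ(e) φ(e) = φ(e)`, and `φ(1) = 1` keeps `φ(e) a = a`. -/
theorem exists_mem_pedZero_mul_eq {e a : A} (he : 0 ≤ e) (h : e * a = a) :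
    ∃ f ∈ pedZero A, f * a = a := by
  have hmax : ∀ t : ℝ, max (1 - t) (1 / 2) ≠ 0 := fun t =>
    (lt_of_lt_of_le (by norm_num) (le_max_right (1 - t) (1 / 2 : ℝ))).ne'
  set φ : ℝ → ℝ := fun t => max 0 (2 * t - 1)
  set ψ : ℝ → ℝ := fun t => min 1 (2 * |t|)
  -- This is the quotient `(φ(t) - t) / (t - 1)`, extended continuously to `t = 1`; hence `φ(e) = e
  -- + r(e) e - r(e)`, and the last two terms cancel on `a`.
  set r : ℝ → ℝ := fun t => min t (1 / 2) / max (1 - t) (1 / 2)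
  have hφ : Continuous φ := by fun_prop
  have hψ : Continuous ψ := by fun_prop
  have hr : Continuous r := (by fun_prop : Continuous fun t : ℝ => min t (1 / 2)).div
    (by fun_prop) hmax
  have hφ0 : φ 0 = 0 := by simp [φ]
  have hψ0 : ψ 0 = 0 := by simp [ψ]
  have hr0 : r 0 = 0 := by simp [r]
  refine ⟨cfcₙ φ e, ⟨cfcₙ_nonneg fun t _ => le_max_left _ _, cfcₙ ψ e,
    cfcₙ_nonneg fun t _ => by positivity, ?_⟩, ?_⟩
  · rw [← cfcₙ_mul ψ φ e (by fun_prop) hψ0 (by fun_prop) hφ0]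
    refine cfcₙ_congr fun t _ => ?_
    rcases le_total (2 * t - 1) 0 with ht | ht
    · simp [φ, max_eq_left ht]
    · have h1 : (1 : ℝ) ≤ 2 * |t| := by rw [abs_of_nonneg (by linarith)]; linarith
      simp [ψ, min_eq_left h1]
  · have key : cfcₙ φ e = e + (cfcₙ r e * e - cfcₙ r e) := by
      have e1 : cfcₙ r e * e = cfcₙ (fun t : ℝ => r t * t) e := by
        rw [cfcₙ_mul r (fun t : ℝ => t) e (by fun_prop) hr0, cfcₙ_id' ℝ e]
      nth_rw 2 [← cfcₙ_id' ℝ e]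
      rw [e1, ← cfcₙ_sub (a := e) (fun t : ℝ => r t * t) r (by fun_prop) (by simp)
        (by fun_prop) hr0,
        ← cfcₙ_add (a := e) (fun t : ℝ => t) (fun t : ℝ => r t * t - r t) (by fun_prop) rfl
        (by fun_prop) (by simp [hr0])]
      refine cfcₙ_congr fun t _ => ?_
      simp only [φ, r]
      rcases le_total t (1 / 2) with ht | ht
      · rw [max_eq_left (by linarith), min_eq_left ht, max_eq_left (by linarith)]
        have : 1 - t ≠ 0 := by linarith
        field_simp
        ring
      · rw [max_eq_right (by linarith), min_eq_right ht, max_eq_right (by linarith)]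
        ring
    rw [key, add_mul, sub_mul, mul_assoc, h]
    abel

theorem sqrt_mul_eq {a f : A} (ha : 0 ≤ a) (h : a * f = a) :
    CFC.sqrt a * f = CFC.sqrt a := by
  have hs := (CFC.sqrt_nonneg a).isSelfAdjoint
  rw [← sub_eq_zero, ← CStarRing.star_mul_self_eq_zero_iff]
  have e : star (CFC.sqrt a * f - CFC.sqrt a) * (CFC.sqrt a * f - CFC.sqrt a)
      = star f * ((CFC.sqrt a * CFC.sqrt a) * f - CFC.sqrt a * CFC.sqrt a)
        - ((CFC.sqrt a * CFC.sqrt a) * f - CFC.sqrt a * CFC.sqrt a) := by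
    simp only [star_sub, star_mul, hs.star_eq]
    noncomm_ring
  rw [e, CFC.sqrt_mul_sqrt_self a ha, h]
  simp

/-- Each `w * unitApprox x n` is a left multiple of `√x`, on which `unitApprox y` acts as a right
approximate unit; such elements form a closed set. -/
theorem RightUnital.of_le {x y w : A} (hx : 0 ≤ x) (hxy : x ≤ y) (hw : RightUnital x w) :
    RightUnital y w := by
  have hy := hx.trans hxy
  have h1 : RightUnital y (CFC.sqrt x) := rightUnital_of_le hy <| by
    rwa [(CFC.sqrt_nonneg x).isSelfAdjoint.star_eq, CFC.sqrt_mul_sqrt_self x hx]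
  refine (isClosed_rightUnital y).mem_of_tendsto hw (Eventually.of_forall fun n => ?_)
  rw [← rootApprox_mul_sqrt hx n]
  exact (h1.mul_left _).mul_left _

theorem her_mono {x y : A} (hx : 0 ≤ x) (hxy : x ≤ y) : her x ≤ her y :=
  fun _ hz => ⟨hz.1.of_le hx hxy, hz.2.of_le hx hxy⟩

/-- Riesz decomposition of `y` along `∑ bⱼ` gives `y = ∑ zⱼ zⱼ⋆`. A right unit `f ∈ Ped A` for `bⱼ`
is one for `√bⱼ`, hence for `zⱼ`, so `zⱼ = zⱼ f` lies in the ideal. -/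
theorem nonneg_mem_Ped_of_mem_her_sum {n : ℕ} {b : Fin n → A} (hb : ∀ j, b j ∈ pedZero A) {y : A}
    (hy : 0 ≤ y) (hyx : y ∈ her (∑ j, b j)) : y ∈ Ped A := by
  have hx : 0 ≤ ∑ j, b j := Finset.sum_nonneg fun j _ => (hb j).1
  have hw : RightUnital (∑ j, b j) (CFC.sqrt y) := RightUnital.sqrt_of_le hy le_rfl hyx.1
  have hsq : ∀ j, CFC.sqrt (b j) * star (CFC.sqrt (b j)) = b j := fun j => by
    rw [(CFC.sqrt_nonneg (b j)).isSelfAdjoint.star_eq, CFC.sqrt_mul_sqrt_self _ (hb j).1]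
  have hle : ∀ j, CFC.sqrt (b j) * star (CFC.sqrt (b j)) ≤ ∑ j, b j := fun j => by
    rw [hsq]
    exact Finset.single_le_sum (fun i _ => (hb i).1) (Finset.mem_univ j)
  choose z hz using fun j => exists_tendsto_mul_rootApprox hx hw (hle j)
  have hzP : ∀ j, z j ∈ Ped A := fun j => by
    obtain ⟨e, he, hea⟩ := (hb j).2
    obtain ⟨f, hf, hfa⟩ := exists_mem_pedZero_mul_eq he hea
    have haf : b j * f = b j := by
      have := congrArg star hfa
      rwa [star_mul, hf.1.isSelfAdjoint.star_eq, (hb j).1.isSelfAdjoint.star_eq] at this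
    have : z j * f = z j := by
      refine tendsto_nhds_unique ((hz j).mul_const f) ((hz j).congr fun n => ?_)
      rw [mul_assoc (CFC.sqrt y * _), sqrt_mul_eq (hb j).1 haf]
    rw [← this]
    exact Ped_mul_mem_left _ (subset_Ped (pedZero_subset_pedCone hf))
  have hsum := sum_mul_star_of_tendsto (s := Finset.univ) hx hw
    (Finset.sum_congr rfl fun j _ => hsq j) fun j _ => hz j
  rw [(CFC.sqrt_nonneg y).isSelfAdjoint.star_eq, CFC.sqrt_mul_sqrt_self y hy] at hsum
  rw [← hsum]
  exact sum_mem fun j _ => Ped_mul_mem_right _ (hzP j)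

theorem le_Ped_of_nonneg {D : NonUnitalStarSubalgebra ℂ A} (hD : IsClosed (D : Set A))
    (h : ∀ y ∈ D, 0 ≤ y → y ∈ Ped A) : D ≤ Ped A := by
  intro y hy
  have := starOrderedRing_of_isClosed hD
  obtain ⟨x, hx, -, hyx⟩ := CStarAlgebra.exists_sum_four_nonneg (⟨y, hy⟩ : D)
  have hyx' : y = ∑ i : Fin 4, Complex.I ^ (i : ℕ) • (x i : A) := by
    have := congrArg (Subtype.val : D → A) hyx
    simpa using this
  rw [hyx']
  exact sum_mem fun i _ => SMulMemClass.smul_mem _ (h _ (x i).2 (hx i))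

/-- The hereditary subalgebra generated by a positive element of the Pedersen ideal is contained
in the Pedersen ideal. -/
theorem her_le_Ped {a : A} (ha : a ∈ pedCone A) : her a ≤ Ped A := by
  obtain ⟨ha0, n, b, hb, hab⟩ := ha
  exact (her_mono ha0 hab).trans <| le_Ped_of_nonneg (isHereditary_her _).isClosed
    fun y hy hy0 => nonneg_mem_Ped_of_mem_her_sum hb hy0 hy

theorem smul_sub_mem_pedCone {a b : A} (ha : a ∈ pedCone A) (hb : b ∈ pedCone A) (r : ℝ) :
    ∃ c ∈ pedCone A, ∃ d ∈ pedCone A, r • (a - b) = c - d := by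
  rcases le_total 0 r with hr | hr
  · exact ⟨_, pedCone_smul r hr ha, _, pedCone_smul r hr hb, smul_sub _ _ _⟩
  · refine ⟨_, pedCone_smul (-r) (by linarith) hb, _, pedCone_smul (-r) (by linarith) ha, ?_⟩
    rw [neg_smul, neg_smul, smul_sub]; abel

theorem zero_mem_pedCone : (0 : A) ∈ pedCone A := ⟨le_rfl, 0, Fin.elim0, fun j => j.elim0, by simp⟩

theorem exists_eq_of_mem_Ped {x : A} (hx : x ∈ Ped A) :
    ∃ a ∈ pedCone A, ∃ b ∈ pedCone A, ∃ c ∈ pedCone A, ∃ d ∈ pedCone A,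
      x = (a - b) + Complex.I • (c - d) := by
  have hx' : x ∈ Submodule.span ℂ (pedCone A) := hx
  clear hx
  induction hx' using Submodule.span_induction with
  | mem a ha => exact ⟨a, ha, 0, zero_mem_pedCone, 0, zero_mem_pedCone, 0, zero_mem_pedCone, by simp⟩
  | zero =>
    exact ⟨0, zero_mem_pedCone, 0, zero_mem_pedCone, 0, zero_mem_pedCone, 0, zero_mem_pedCone,
      by simp⟩
  | add x y _ _ hx hy =>
    obtain ⟨a, ha, b, hb, c, hc, d, hd, rfl⟩ := hx
    obtain ⟨a', ha', b', hb', c', hc', d', hd', rfl⟩ := hy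
    refine ⟨_, pedCone_add ha ha', _, pedCone_add hb hb', _, pedCone_add hc hc', _,
      pedCone_add hd hd', ?_⟩
    simp only [smul_sub, smul_add]
    abel
  | smul z x _ hx =>
    obtain ⟨a, ha, b, hb, c, hc, d, hd, rfl⟩ := hx
    obtain ⟨a1, ha1, b1, hb1, h1⟩ := smul_sub_mem_pedCone ha hb z.re
    obtain ⟨a2, ha2, b2, hb2, h2⟩ := smul_sub_mem_pedCone ha hb z.im
    obtain ⟨c1, hc1, d1, hd1, h3⟩ := smul_sub_mem_pedCone hc hd z.re
    obtain ⟨c2, hc2, d2, hd2, h4⟩ := smul_sub_mem_pedCone hc hd z.im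
    refine ⟨_, pedCone_add ha1 hd2, _, pedCone_add hb1 hc2, _, pedCone_add hc1 ha2, _,
      pedCone_add hd1 hb2, ?_⟩
    have e1 : a1 + d2 - (b1 + c2) = z.re • (a - b) - z.im • (c - d) := by rw [h1, h4]; abel
    have e2 : c1 + a2 - (d1 + b2) = z.re • (c - d) + z.im • (a - b) := by rw [h3, h2]; abel
    rw [e1, e2]
    simp only [← Complex.coe_smul, smul_add, smul_smul]
    conv_lhs => rw [← Complex.re_add_im z]
    have hI : (z.im : ℂ) * Complex.I * Complex.I = -(z.im : ℂ) := by
      rw [mul_assoc, Complex.I_mul_I]; ring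
    simp only [add_smul, add_mul, hI, neg_smul, mul_comm Complex.I]
    abel

theorem exists_eq_sub_of_isSelfAdjoint {x : A} (hx : x ∈ Ped A) (hs : IsSelfAdjoint x) :
    ∃ a ∈ pedCone A, ∃ b ∈ pedCone A, x = a - b := by
  obtain ⟨a, ha, b, hb, c, hc, d, hd, h⟩ := exists_eq_of_mem_Ped hx
  refine ⟨a, ha, b, hb, ?_⟩
  have hab : IsSelfAdjoint (a - b) := ha.1.isSelfAdjoint.sub hb.1.isSelfAdjoint
  have hcd : IsSelfAdjoint (c - d) := hc.1.isSelfAdjoint.sub hd.1.isSelfAdjoint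
  have h2 := hs.star_eq
  rw [h, star_add, star_smul, hab.star_eq, hcd.star_eq] at h2
  have h3 : (2 : ℂ) • Complex.I • (c - d) = 0 := by
    have h4 := add_left_cancel h2
    simp only [RCLike.star_def, Complex.conj_I, neg_smul] at h4
    rw [two_smul]
    nth_rw 1 [← h4]
    exact neg_add_cancel _
  rw [h, (smul_eq_zero.1 h3).resolve_left two_ne_zero, add_zero]

/-- The positive elements of the Pedersen ideal are the elements of the defining cone. -/
theorem mem_pedCone_iff {x : A} : x ∈ pedCone A ↔ x ∈ Ped A ∧ 0 ≤ x := by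
  refine ⟨fun h => ⟨subset_Ped h, h.1⟩, fun ⟨h, h0⟩ => ?_⟩
  obtain ⟨a, ha, b, hb, rfl⟩ := exists_eq_sub_of_isSelfAdjoint h h0.isSelfAdjoint
  exact pedCone_of_le h0 (sub_le_self _ hb.1) ha

theorem sqrt_mem_Ped {b : A} (hb : b ∈ pedCone A) : CFC.sqrt b ∈ Ped A :=
  her_le_Ped hb (sqrt_mem_of_isClosed (isHereditary_her b).isClosed hb.1 (self_mem_her hb.1))

theorem linearMap_ext_pedCone {φ ψ : Ped A →ₗ[ℂ] ℂ}
    (h : ∀ x : Ped A, 0 ≤ (x : A) → φ x = ψ x) : φ = ψ := by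
  ext x
  obtain ⟨a, ha, b, hb, c, hc, d, hd, hx⟩ := exists_eq_of_mem_Ped x.2
  have : x = ((⟨a, subset_Ped ha⟩ : Ped A) - ⟨b, subset_Ped hb⟩)
      + Complex.I • ((⟨c, subset_Ped hc⟩ : Ped A) - ⟨d, subset_Ped hd⟩) := Subtype.ext hx
  rw [this]
  simp only [map_add, map_sub, map_smul]
  rw [h _ ha.1, h _ hb.1, h _ hc.1, h _ hd.1]

end PedersenIdeal

/-! ### Continuity, traciality, linear extension and Riesz decomposition. -/

section Functionals

open Filter Topology

variable {A : Type u} [NonUnitalCStarAlgebra A] [PartialOrder A] [StarOrderedRing A]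

theorem continuous_restrict_of_continuous {τ : Ped A →ₗ[ℂ] ℂ}
    (hτ : @Continuous (Ped A) ℂ (pedTopology A) _ τ) {D : NonUnitalStarSubalgebra ℂ A}
    (hD : IsClosed (D : Set A)) (hDP : D ≤ Ped A) :
    Continuous fun x : D => τ (NonUnitalStarSubalgebra.inclusion hDP x) := by
  have h : @Continuous D (Ped A) _ (pedTopology A) (NonUnitalStarSubalgebra.inclusion hDP) :=
    continuous_sInf_rng.2 fun t ht => ht.2.2.2 D hD hDP
  exact @Continuous.comp _ _ _ _ (pedTopology A) _ _ _ hτ h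

/-- The topology induced by `τ` is itself one of the locally convex topologies whose infimum defines
`pedTopology A`. -/
theorem continuous_of_continuous_restrict {τ : Ped A →ₗ[ℂ] ℂ}
    (h : ∀ (D : NonUnitalStarSubalgebra ℂ A) (_ : IsClosed (D : Set A)) (hDP : D ≤ Ped A),
      Continuous fun x : D => τ (NonUnitalStarSubalgebra.inclusion hDP x)) :
    @Continuous (Ped A) ℂ (pedTopology A) _ τ := by
  refine continuous_sInf_dom (t₁ := _)
    (t := TopologicalSpace.induced τ inferInstance) ⟨?_, ?_, ?_, ?_⟩ continuous_induced_dom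
  · exact topologicalAddGroup_induced τ
  · exact continuousSMul_induced τ
  · exact LocallyConvexSpace.induced (τ.restrictScalars ℝ)
  · exact fun D hD hDP => continuous_induced_rng.2 (h D hD hDP)

theorem exists_bound_of_continuous {τ : Ped A →ₗ[ℂ] ℂ}
    (hτ : @Continuous (Ped A) ℂ (pedTopology A) _ τ) {D : NonUnitalStarSubalgebra ℂ A}
    (hD : IsClosed (D : Set A)) (hDP : D ≤ Ped A) :
    ∃ C : ℝ, 0 ≤ C ∧ ∀ (x : Ped A), (x : A) ∈ D → ‖τ x‖ ≤ C * ‖(x : A)‖ := by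
  let f : D →L[ℂ] ℂ := ⟨τ ∘ₗ (NonUnitalStarSubalgebra.inclusion hDP : D →ₗ[ℂ] Ped A),
    continuous_restrict_of_continuous hτ hD hDP⟩
  exact ⟨‖f‖, norm_nonneg _, fun x hx => f.le_opNorm ⟨x, hx⟩⟩

theorem isSelfAdj_im_eq_zero {τ : Ped A →ₗ[ℂ] ℂ} (hτ : IsSelfAdj τ) {x : Ped A}
    (hx : IsSelfAdjoint (x : A)) : (τ x).im = 0 := by
  have h := hτ x
  rw [show star x = x from Subtype.ext hx.star_eq] at h
  exact Complex.conj_eq_iff_im.1 h.symm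

theorem isSelfAdj_of_isPositive {τ : Ped A →ₗ[ℂ] ℂ} (hτ : IsPositive τ) : IsSelfAdj τ := by
  have key : ∀ x : Ped A, 0 ≤ (x : A) → star (τ x) = τ x := fun x hx =>
    (IsSelfAdjoint.of_nonneg (hτ x hx)).star_eq
  intro x
  obtain ⟨a, ha, b, hb, c, hc, d, hd, hx⟩ := exists_eq_of_mem_Ped x.2
  have e : x = ((⟨a, subset_Ped ha⟩ : Ped A) - ⟨b, subset_Ped hb⟩)
      + Complex.I • ((⟨c, subset_Ped hc⟩ : Ped A) - ⟨d, subset_Ped hd⟩) := Subtype.ext hx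
  have s : ∀ {a : A} (ha : a ∈ pedCone A),
      star (⟨a, subset_Ped ha⟩ : Ped A) = ⟨a, subset_Ped ha⟩ :=
    fun ha => Subtype.ext ha.1.isSelfAdjoint.star_eq
  have key' : ∀ {a : A} (ha : a ∈ pedCone A),
      star (τ ⟨a, subset_Ped ha⟩) = τ ⟨a, subset_Ped ha⟩ := fun ha => key _ ha.1
  rw [e]
  simp only [star_add, star_sub, star_smul, s ha, s hb, s hc, s hd, map_add, map_sub, map_smul,
    smul_eq_mul, star_mul', key' ha, key' hb, key' hc, key' hd]

theorem continuous_of_isPositive {τ : Ped A →ₗ[ℂ] ℂ} (hτ : IsPositive τ) :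
    @Continuous (Ped A) ℂ (pedTopology A) _ τ := by
  refine continuous_of_continuous_restrict fun D hD hDP => ?_
  have := starOrderedRing_of_isClosed hD
  let f : D →ₗ[ℂ] ℂ := τ ∘ₗ (NonUnitalStarSubalgebra.inclusion hDP : D →ₗ[ℂ] Ped A)
  let p : D →ₚ[ℂ] ℂ := PositiveLinearMap.mk₀ f fun x hx => hτ _ hx
  exact map_continuous p

/-- Polarization, comparing the identity at `x + y` and at `x + i y`. -/
theorem isTracial_of_star_mul_self {φ : Ped A →ₗ[ℂ] ℂ}
    (h : ∀ x : Ped A, φ (x * star x) = φ (star x * x)) : IsTracial φ := by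
  have h1 : ∀ x y : Ped A, φ (x * star y) + φ (y * star x) = φ (star y * x) + φ (star x * y) := by
    intro x y
    have := h (x + y)
    simp only [star_add, add_mul, mul_add, map_add, h x, h y] at this
    linear_combination this
  have h2 : ∀ x y : Ped A, φ (x * star y) = φ (star y * x) := by
    intro x y
    have e1 := h1 x y
    have e2 := h1 x (Complex.I • y)
    simp only [star_smul, RCLike.star_def, Complex.conj_I, mul_smul_comm, smul_mul_assoc, map_smul,
      smul_eq_mul] at e2
    have hI : Complex.I ≠ 0 := Complex.I_ne_zero
    have e3 : -φ (x * star y) + φ (y * star x) = -φ (star y * x) + φ (star x * y) := by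
      refine mul_left_cancel₀ hI ?_
      linear_combination e2
    linear_combination (e1 - e3) / 2
  intro x y
  simpa using h2 x (star y)

/-- The real part of an element of `Ped A` is a difference `a - b` of cone elements, and additivity
makes `f a - f b` independent of the choice. The resulting real functional is then complexified. -/
theorem exists_linearMap_of_additive {f : A → ℝ}
    (hadd : ∀ a ∈ pedCone A, ∀ b ∈ pedCone A, f (a + b) = f a + f b)
    (hsmul : ∀ r : ℝ, 0 ≤ r → ∀ a ∈ pedCone A, f (r • a) = r * f a) :
    ∃ φ : Ped A →ₗ[ℂ] ℂ, ∀ x : Ped A, 0 ≤ (x : A) → φ x = f x := by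
  have hre : ∀ x : Ped A, ∃ a ∈ pedCone A, ∃ b ∈ pedCone A, (realPart (x : A) : A) = a - b := by
    refine fun x => exists_eq_sub_of_isSelfAdjoint ?_ (realPart (x : A)).2
    rw [realPart_apply_coe]
    rw [← Complex.coe_smul]
    exact SMulMemClass.smul_mem _ (add_mem x.2 (star_mem x.2))
  choose p hp q hq hpq using hre
  have key : ∀ (x : Ped A), ∀ a ∈ pedCone A, ∀ b ∈ pedCone A, (realPart (x : A) : A) = a - b →
      f (p x) - f (q x) = f a - f b := by
    intro x a ha b hb hab
    have e : p x + b = a + q x := by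
      rw [hpq, sub_eq_sub_iff_add_eq_add] at hab
      exact hab
    have := congrArg f e
    rw [hadd _ (hp x) _ hb, hadd _ ha _ (hq x)] at this
    linarith
  let F : Module.Dual ℝ (Ped A) :=
    { toFun := fun x => f (p x) - f (q x)
      map_add' := fun x y => by
        rw [key (x + y) _ (pedCone_add (hp x) (hp y)) _ (pedCone_add (hq x) (hq y)),
          hadd _ (hp x) _ (hp y), hadd _ (hq x) _ (hq y)]
        · ring
        · have : ((x + y : Ped A) : A) = x + y := rfl
          rw [this, map_add, AddSubgroup.coe_add, hpq, hpq]
          abel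
      map_smul' := fun r x => by
        have e : ((r • x : Ped A) : A) = r • (x : A) := rfl
        have e' : (realPart ((r • x : Ped A) : A) : A) = r • (p x - q x) := by
          rw [e, map_smul, selfAdjoint.val_smul, hpq]
        simp only [RingHom.id_apply, smul_eq_mul]
        rcases le_total 0 r with hr | hr
        · rw [key (r • x) _ (pedCone_smul r hr (hp x)) _ (pedCone_smul r hr (hq x)),
            hsmul r hr _ (hp x), hsmul r hr _ (hq x)]
          · ring
          · rw [e', smul_sub]
        · have hr' : 0 ≤ -r := by linarith
          rw [key (r • x) _ (pedCone_smul (-r) hr' (hq x)) _ (pedCone_smul (-r) hr' (hp x)),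
            hsmul _ hr' _ (hp x), hsmul _ hr' _ (hq x)]
          · ring
          · rw [e', smul_sub, neg_smul, neg_smul]; abel }
  have hf0 : f 0 = 0 := by
    have := hsmul 0 le_rfl 0 zero_mem_pedCone
    simpa using this
  -- The extension is `x ↦ F x - i F (i x)`; its second term vanishes for `x ≥ 0`, since `i x` has
  -- real part zero.
  refine ⟨Module.Dual.extendRCLike F, fun x hx => ?_⟩
  have h1 : F x = f x := by
    change f (p x) - f (q x) = f x
    rw [key x x (mem_pedCone_iff.2 ⟨x.2, hx⟩) 0 zero_mem_pedCone, hf0, sub_zero]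
    rw [sub_zero, hx.isSelfAdjoint.coe_realPart]
  have h2 : F ((RCLike.I : ℂ) • x) = 0 := by
    change f (p _) - f (q _) = 0
    rw [key _ 0 zero_mem_pedCone 0 zero_mem_pedCone, sub_self]
    have e : (((RCLike.I : ℂ) • x : Ped A) : A) = Complex.I • (x : A) := rfl
    rw [e, realPart_I_smul, hx.isSelfAdjoint.imaginaryPart]
    simp
  rw [Module.Dual.extendRCLike_apply, h1, h2]
  simp

/-- Riesz decomposition in the Pedersen ideal, up to the equivalence `z z⋆ ∼ z⋆ z`. -/
theorem exists_riesz_decomposition {ι : Type*} {s : Finset ι} {x b : A} {y : ι → A}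
    (hx : x ∈ pedCone A) (hy : ∑ i ∈ s, y i * star (y i) = x) (hb : 0 ≤ b) (hbx : b ≤ x) :
    ∃ z : ι → Ped A, ∑ i ∈ s, (z i : A) * star (z i : A) = b ∧
      ∀ i ∈ s, star (z i : A) * (z i : A) ≤ star (y i) * y i := by
  classical
  set w := CFC.sqrt b
  set v := CFC.sqrt w
  have hbC := pedCone_of_le hb hbx hx
  have hw0 : 0 ≤ w := CFC.sqrt_nonneg b
  have hwC : w ∈ pedCone A := mem_pedCone_iff.2 ⟨sqrt_mem_Ped hbC, hw0⟩
  have hww : w * w = b := CFC.sqrt_mul_sqrt_self b hb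
  have hvv : v * v = w := CFC.sqrt_mul_sqrt_self w hw0
  have hwx : star w * w ≤ x := by rwa [hw0.isSelfAdjoint.star_eq, hww]
  have hw : RightUnital x w := rightUnital_of_le hx.1 hwx
  have hv : RightUnital x v := hw.sqrt_of_le hw0 le_rfl
  have hle : ∀ i ∈ s, y i * star (y i) ≤ x := fun i hi => by
    rw [← hy]
    exact Finset.single_le_sum (f := fun i => y i * star (y i))
      (fun i _ => mul_star_self_nonneg (y i)) hi
  have hz : ∀ i, ∃ z : Ped A, i ∈ s →
      Tendsto (fun n => w * rootApprox x n * y i) atTop (𝓝 (z : A)) := by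
    intro i
    by_cases hi : i ∈ s
    · obtain ⟨z, hz⟩ := exists_tendsto_mul_rootApprox hx.1 hv (hle i hi)
      -- The limit built from `w = √b` is only known to lie in `A`. Splitting `w = v * v` and taking
      -- the limit with one factor leaves `v ∈ Ped A` in front.
      refine ⟨⟨v * z, Ped_mul_mem_right _ (sqrt_mem_Ped hwC)⟩, fun _ => ?_⟩
      simpa only [← mul_assoc, hvv] using hz.const_mul v
    · exact ⟨0, fun h => absurd h hi⟩
  choose z hz using hz
  refine ⟨z, ?_, fun i hi => star_mul_self_le_of_tendsto hx.1 hwx (hz i hi)⟩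
  rw [sum_mul_star_of_tendsto hx.1 hw hy hz, hw0.isSelfAdjoint.star_eq, hww]

end Functionals

/-! ### The positive part as a supremum over order intervals. -/

section PositivePart

variable {A : Type u} [NonUnitalCStarAlgebra A] [PartialOrder A] [StarOrderedRing A]

/-- The values of `τ` on the order interval `[0, a]`. -/
def intervalValues (τ : Ped A →ₗ[ℂ] ℂ) (a : A) : Set ℝ :=
  {r | ∃ b : Ped A, 0 ≤ (b : A) ∧ (b : A) ≤ a ∧ (τ b).re = r}

theorem zero_mem_intervalValues (τ : Ped A →ₗ[ℂ] ℂ) {a : A} (ha : 0 ≤ a) :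
    (0 : ℝ) ∈ intervalValues τ a := ⟨0, le_rfl, ha, by simp⟩

variable {τ : Ped A →ₗ[ℂ] ℂ}

theorem bddAbove_intervalValues (hτ : τ ∈ TR A) {a : A} (ha : a ∈ pedCone A) :
    BddAbove (intervalValues τ a) := by
  obtain ⟨C, hC, h⟩ := exists_bound_of_continuous hτ.1 (isHereditary_her a).isClosed
    (her_le_Ped ha)
  refine ⟨C * ‖a‖, ?_⟩
  rintro r ⟨b, hb, hba, rfl⟩
  refine (Complex.re_le_norm _).trans
    ((h b ((isHereditary_her a).mem_of_le _ _ hb hba (self_mem_her ha.1))).trans ?_)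
  gcongr
  exact CStarAlgebra.norm_le_norm_of_nonneg_of_le hb hba

theorem le_sSup_intervalValues (hτ : τ ∈ TR A) {a : A} (ha : a ∈ pedCone A) {b : Ped A}
    (hb : 0 ≤ (b : A)) (hba : (b : A) ≤ a) : (τ b).re ≤ sSup (intervalValues τ a) :=
  le_csSup (bddAbove_intervalValues hτ ha) ⟨b, hb, hba, rfl⟩

theorem sSup_intervalValues_le {a : A} (ha : 0 ≤ a) {c : ℝ}
    (h : ∀ b : Ped A, 0 ≤ (b : A) → (b : A) ≤ a → (τ b).re ≤ c) :
    sSup (intervalValues τ a) ≤ c := by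
  refine csSup_le ⟨0, zero_mem_intervalValues τ ha⟩ ?_
  rintro r ⟨b, hb, hba, rfl⟩
  exact h b hb hba

/-- Riesz decomposition writes `b = ∑ zᵢ zᵢ⋆`; the trace property turns `τ(zᵢ zᵢ⋆)` into `τ(zᵢ⋆
zᵢ)`, a value of `τ` on `[0, yᵢ⋆ yᵢ]`. -/
theorem re_le_sum_sSup_intervalValues (hτ : τ ∈ TR A) {ι : Type*} {s : Finset ι} {x : A}
    {y : ι → A} {b : Ped A} (hx : x ∈ pedCone A) (hy : ∑ i ∈ s, y i * star (y i) = x)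
    (hys : ∀ i ∈ s, star (y i) * y i ∈ pedCone A) (hb : 0 ≤ (b : A)) (hbx : (b : A) ≤ x) :
    (τ b).re ≤ ∑ i ∈ s, sSup (intervalValues τ (star (y i) * y i)) := by
  obtain ⟨z, hz, hzy⟩ := exists_riesz_decomposition hx hy hb hbx
  have e : b = ∑ i ∈ s, z i * star (z i) := by
    refine Subtype.ext (hz.symm.trans ?_)
    simp
  rw [e, map_sum, Complex.re_sum]
  refine Finset.sum_le_sum fun i hi => ?_
  rw [hτ.2.2]
  exact le_sSup_intervalValues hτ (hys i hi) (star_mul_self_nonneg (z i : A)) (hzy i hi)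

theorem sSup_intervalValues_add (hτ : τ ∈ TR A) {a b : A} (ha : a ∈ pedCone A)
    (hb : b ∈ pedCone A) : sSup (intervalValues τ (a + b))
      = sSup (intervalValues τ a) + sSup (intervalValues τ b) := by
  have hab := pedCone_add ha hb
  have hsa := CFC.sqrt_mul_sqrt_self a ha.1
  have hsb := CFC.sqrt_mul_sqrt_self b hb.1
  have ha' := (CFC.sqrt_nonneg a).isSelfAdjoint.star_eq
  have hb' := (CFC.sqrt_nonneg b).isSelfAdjoint.star_eq
  refine le_antisymm (sSup_intervalValues_le hab.1 fun c hc hcab => ?_) ?_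
  · have := re_le_sum_sSup_intervalValues hτ (s := Finset.univ) (y := ![CFC.sqrt a, CFC.sqrt b])
      hab (by simp [ha', hb', hsa, hsb]) (by
        intro i _
        fin_cases i
        · simpa [ha', hsa] using ha
        · simpa [hb', hsb] using hb) hc hcab
    simpa [ha', hb', hsa, hsb] using this
  · rw [← le_sub_iff_add_le]
    refine sSup_intervalValues_le ha.1 fun c hc hca => ?_
    rw [le_sub_iff_add_le, ← le_sub_iff_add_le']
    refine sSup_intervalValues_le hb.1 fun d hd hdb => ?_
    rw [le_sub_iff_add_le', ← Complex.add_re, ← map_add]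
    exact le_sSup_intervalValues hτ hab (add_nonneg hc hd) (add_le_add hca hdb)

theorem sSup_intervalValues_smul (hτ : τ ∈ TR A) {r : ℝ} (hr : 0 ≤ r) {a : A}
    (ha : a ∈ pedCone A) : sSup (intervalValues τ (r • a)) = r * sSup (intervalValues τ a) := by
  have key : ∀ {r : ℝ}, 0 < r → ∀ {a : A}, a ∈ pedCone A →
      sSup (intervalValues τ (r • a)) ≤ r * sSup (intervalValues τ a) := by
    intro r hr a ha
    refine sSup_intervalValues_le (smul_nonneg hr.le ha.1) fun b hb hba => ?_
    have hle : (((r⁻¹ : ℝ) : ℂ) • b : A) ≤ a := by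
      rw [Complex.coe_smul]
      calc r⁻¹ • (b : A) ≤ r⁻¹ • r • a := smul_le_smul_of_nonneg_left hba (by positivity)
        _ = a := inv_smul_smul₀ hr.ne' a
    have hnn : (0 : A) ≤ ((r⁻¹ : ℝ) : ℂ) • (b : A) := by
      rw [Complex.coe_smul]
      exact smul_nonneg (by positivity) hb
    have := le_sSup_intervalValues hτ ha (b := ((r⁻¹ : ℝ) : ℂ) • b) hnn hle
    rwa [map_smul, smul_eq_mul, Complex.re_ofReal_mul, inv_mul_le_iff₀ hr] at this
  rcases hr.eq_or_lt with rfl | hr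
  · rw [zero_smul, zero_mul]
    refine le_antisymm (sSup_intervalValues_le le_rfl fun b hb hb0 => ?_)
      (le_sSup_intervalValues hτ zero_mem_pedCone (b := 0) le_rfl le_rfl |>.trans_eq' (by simp))
    rw [show b = 0 from Subtype.ext (le_antisymm hb0 hb)]
    simp
  -- The reverse inequality is `key` for `r⁻¹` at `r • a`.
  · refine le_antisymm (key hr ha) ?_
    have := key (inv_pos.2 hr) (pedCone_smul r hr.le ha)
    rwa [inv_smul_smul₀ hr.ne', le_inv_mul_iff₀ hr] at this

theorem mul_star_mem_pedCone (x : Ped A) : (x : A) * star (x : A) ∈ pedCone A :=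
  mem_pedCone_iff.2 ⟨mul_mem x.2 (star_mem x.2), mul_star_self_nonneg _⟩

theorem star_mul_mem_pedCone (x : Ped A) : star (x : A) * (x : A) ∈ pedCone A :=
  mem_pedCone_iff.2 ⟨mul_mem (star_mem x.2) x.2, star_mul_self_nonneg _⟩

theorem sSup_intervalValues_mul_star_le (hτ : τ ∈ TR A) (x : Ped A) :
    sSup (intervalValues τ ((x : A) * star (x : A)))
      ≤ sSup (intervalValues τ (star (x : A) * (x : A))) := by
  refine sSup_intervalValues_le (mul_star_self_nonneg _) fun b hb hbx => ?_
  have := re_le_sum_sSup_intervalValues hτ (s := {()}) (y := fun _ => (x : A))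
    (mul_star_mem_pedCone x) (by simp) (fun _ _ => star_mul_mem_pedCone x) hb hbx
  simpa using this

/-- The positive part of a continuous self-adjoint trace on the Pedersen ideal. -/
theorem exists_posPart (hτ : τ ∈ TR A) : ∃ φ : Ped A →ₗ[ℂ] ℂ, IsTracial φ ∧
    ∀ x : Ped A, 0 ≤ (x : A) → φ x = (sSup (intervalValues τ (x : A)) : ℝ) := by
  obtain ⟨φ, hφ⟩ := exists_linearMap_of_additive (f := fun a => sSup (intervalValues τ a))
    (fun a ha b hb => sSup_intervalValues_add hτ ha hb)
    (fun r hr a ha => sSup_intervalValues_smul hτ hr ha)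
  refine ⟨φ, isTracial_of_star_mul_self fun x => ?_, hφ⟩
  rw [hφ _ (mul_star_self_nonneg (x : A)), hφ _ (star_mul_self_nonneg (x : A))]
  refine congrArg _ (le_antisymm (sSup_intervalValues_mul_star_le hτ x) ?_)
  simpa using sSup_intervalValues_mul_star_le hτ (star x)

end PositivePart

/-! ### Jordan decompositions of bounded functionals on a C⋆-algebra. -/

section JordanDecomposition

variable {B : Type u} [NonUnitalCStarAlgebra B] [PartialOrder B] [StarOrderedRing B]

/-- Rotate a nearly norming `x` so that `φ x > 0`, and write it as `p₀ + i p₁ - p₂ - i p₃` with `pᵢ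
≥ 0`: then `φ x = φ p₀ - φ p₂ ≤ φ p₀`. -/
theorem exists_nonneg_lt_re_apply {φ : B →L[ℂ] ℂ} (hφ : ∀ x, 0 ≤ x → 0 ≤ φ x) {r : ℝ}
    (hr0 : 0 ≤ r) (hr : r < ‖φ‖) : ∃ a : B, 0 ≤ a ∧ ‖a‖ < 1 ∧ r < (φ a).re := by
  obtain ⟨x, hx, hrx⟩ := ContinuousLinearMap.exists_lt_apply_of_lt_opNorm φ hr
  have hne : φ x ≠ 0 := fun h => by rw [h, norm_zero] at hrx; linarith
  set c : ℂ := star (φ x) / ‖φ x‖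
  have hc : ‖c‖ = 1 := by
    simp only [c, norm_div, norm_star, Complex.norm_real, norm_norm]
    exact div_self (norm_ne_zero_iff.2 hne)
  have hcx : (φ (c • x)).re = ‖φ x‖ := by
    have : φ (c • x) = ‖φ x‖ := by
      rw [map_smul, smul_eq_mul, div_mul_eq_mul_div, RCLike.star_def, Complex.conj_mul', sq,
        mul_div_assoc, div_self (by simpa using hne), mul_one]
    rw [this, Complex.ofReal_re]
  obtain ⟨p, hp, hpn, hsum⟩ := CStarAlgebra.exists_sum_four_nonneg (c • x)
  have him : ∀ i, (φ (p i)).im = 0 := fun i => ((Complex.nonneg_iff.1 (hφ _ (hp i))).2).symm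
  have hre : ∀ i, 0 ≤ (φ (p i)).re := fun i => (Complex.nonneg_iff.1 (hφ _ (hp i))).1
  refine ⟨p 0, hp 0, ?_, ?_⟩
  · exact (hpn 0).trans_lt (by rwa [norm_smul, hc, one_mul])
  · rw [hsum, map_sum, Fin.sum_univ_four] at hcx
    have h3 : Complex.I ^ 3 = -Complex.I := Complex.I_pow_three
    simp [him, h3] at hcx
    linarith [hre 2]

theorem exists_nonneg_sub_lt_re_apply {φ : B →L[ℂ] ℂ} (hφ : ∀ x, 0 ≤ x → 0 ≤ φ x) {ε : ℝ}
    (hε : 0 < ε) : ∃ a : B, 0 ≤ a ∧ ‖a‖ < 1 ∧ ‖φ‖ - ε < (φ a).re := by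
  rcases lt_or_ge (‖φ‖ - ε) 0 with h | h
  · exact ⟨0, le_rfl, by simp, by simpa using h⟩
  · exact exists_nonneg_lt_re_apply hφ h (by linarith)

/-- The positive elements of the open unit ball are directed upwards, so near-maximizers for `φ` and
`ψ` have a common upper bound there. This makes the norm additive on positive functionals. -/
theorem exists_common_nonneg_sub_lt {φ ψ : B →L[ℂ] ℂ} (hφ : ∀ x, 0 ≤ x → 0 ≤ φ x)
    (hψ : ∀ x, 0 ≤ x → 0 ≤ ψ x) {ε : ℝ} (hε : 0 < ε) :
    ∃ a : B, 0 ≤ a ∧ ‖a‖ < 1 ∧ ‖φ‖ - ε < (φ a).re ∧ ‖ψ‖ - ε < (ψ a).re := by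
  obtain ⟨a, ha, han, haφ⟩ := exists_nonneg_sub_lt_re_apply hφ hε
  obtain ⟨b, hb, hbn, hbψ⟩ := exists_nonneg_sub_lt_re_apply hψ hε
  obtain ⟨c, ⟨hc, hcn⟩, hac, hbc⟩ := CStarAlgebra.directedOn_nonneg_ball (A := B) a
    ⟨ha, by simpa using han⟩ b ⟨hb, by simpa using hbn⟩
  have mono : ∀ {φ : B →L[ℂ] ℂ}, (∀ x, 0 ≤ x → 0 ≤ φ x) → ∀ {x y : B}, x ≤ y →
      (φ x).re ≤ (φ y).re := by
    intro φ hφ x y hxy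
    have := (Complex.nonneg_iff.1 (hφ _ (sub_nonneg.2 hxy))).1
    rw [map_sub, Complex.sub_re] at this
    linarith
  exact ⟨c, hc, by simpa using hcn, haφ.trans_le (mono hφ hac), hbψ.trans_le (mono hψ hbc)⟩

theorem norm_add_of_nonneg {φ ψ : B →L[ℂ] ℂ} (hφ : ∀ x, 0 ≤ x → 0 ≤ φ x)
    (hψ : ∀ x, 0 ≤ x → 0 ≤ ψ x) : ‖φ + ψ‖ = ‖φ‖ + ‖ψ‖ := by
  refine le_antisymm (norm_add_le _ _) (le_of_forall_pos_lt_add fun ε hε => ?_)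
  obtain ⟨a, -, han, h1, h2⟩ := exists_common_nonneg_sub_lt hφ hψ (half_pos hε)
  have h3 : ((φ + ψ) a).re ≤ ‖φ + ψ‖ :=
    (Complex.re_le_norm _).trans ((φ + ψ).unit_le_opNorm a han.le)
  rw [add_apply, Complex.add_re] at h3
  linarith

/-- In the unitization `-‖a‖ ≤ h ≤ ‖a‖`, and `‖h‖` or `-‖h‖` is in the spectrum of `h`. -/
theorem norm_le_norm_of_neg_le_of_le {a h : B} (h1 : -a ≤ h) (h2 : h ≤ a) : ‖h‖ ≤ ‖a‖ := by
  have ha : 0 ≤ a := by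
    have : (0 : B) ≤ (2 : ℝ) • a := by
      rw [two_smul, ← neg_le_iff_add_nonneg']
      exact h1.trans h2
    have h := smul_nonneg (by norm_num : (0 : ℝ) ≤ 1 / 2) this
    rwa [smul_smul, show (1 / 2 : ℝ) * 2 = 1 by norm_num, one_smul] at h
  have hh : IsSelfAdjoint h := by
    have := ((sub_nonneg.2 h2).isSelfAdjoint)
    simpa using ha.isSelfAdjoint.sub this
  have hU : IsSelfAdjoint (h : Unitization ℂ B) := hh.inr ℂ
  have ha' : (0 : Unitization ℂ B) ≤ (a : Unitization ℂ B) := Unitization.inr_nonneg_iff.2 ha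
  rw [← Unitization.norm_inr (𝕜 := ℂ) (a := h), ← Unitization.norm_inr (𝕜 := ℂ) (a := a)]
  have u1 : (h : Unitization ℂ B) ≤ algebraMap ℝ _ ‖(a : Unitization ℂ B)‖ :=
    ((Unitization.inr_le_iff h a hh ha.isSelfAdjoint).2 h2).trans
      ha'.isSelfAdjoint.le_algebraMap_norm_self
  have u2 : algebraMap ℝ _ (-‖(a : Unitization ℂ B)‖) ≤ (h : Unitization ℂ B) := by
    refine le_trans ?_ ((Unitization.inr_le_iff (-a) h ha.isSelfAdjoint.neg hh).2 h1)
    rw [map_neg, Unitization.inr_neg, neg_le_neg_iff]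
    exact ha'.isSelfAdjoint.le_algebraMap_norm_self
  rw [le_algebraMap_iff_spectrum_le] at u1
  rw [algebraMap_le_iff_le_spectrum] at u2
  rcases CStarAlgebra.norm_or_neg_norm_mem_spectrum hU with hs | hs
  · exact u1 _ hs
  · exact neg_le_neg_iff.1 (u2 _ hs)

/-- If `ρ₁` is the supremum of `ρ` over order intervals, then `(ρ₁, ρ₂)` is the Jordan
decomposition of `ρ = ρ₁ - ρ₂`. -/
theorem isJordanDecomposition_of_approx {ρ ρ₁ ρ₂ : B →L[ℂ] ℂ} (h₁ : ∀ x, 0 ≤ x → 0 ≤ ρ₁ x)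
    (h₂ : ∀ x, 0 ≤ x → 0 ≤ ρ₂ x) (h : ρ = ρ₁ - ρ₂)
    (hap : ∀ a, 0 ≤ a → ∀ ε > 0, ∃ b, 0 ≤ b ∧ b ≤ a ∧ (ρ₁ a).re < (ρ b).re + ε) :
    IsJordanDecomposition ρ ρ₁ ρ₂ := by
  refine ⟨h₁, h₂, h, le_antisymm (h ▸ norm_sub_le _ _) (le_of_forall_pos_lt_add fun ε hε => ?_)⟩
  obtain ⟨a, ha, han, h3, h4⟩ := exists_common_nonneg_sub_lt h₁ h₂ (ε := ε / 4) (by positivity)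
  obtain ⟨b, hb, hba, h5⟩ := hap a ha (ε / 4) (by positivity)
  -- The contraction `2b - a` nearly attains the norm: `ρ(2b - a) = 2 ρ(b) - ρ₁(a) + ρ₂(a)` is close
  -- to `ρ₁(a) + ρ₂(a)`, hence to `‖ρ₁‖ + ‖ρ₂‖`.
  have hn : ‖(b + b - a : B)‖ ≤ 1 := by
    refine (norm_le_norm_of_neg_le_of_le (a := a) ?_ ?_).trans han.le
    · rw [neg_le_sub_iff_le_add]
      exact le_add_of_nonneg_left (add_nonneg hb hb)
    · rw [sub_le_iff_le_add]
      exact add_le_add hba hba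
  have h6 : (ρ (b + b - a)).re ≤ ‖ρ‖ :=
    (Complex.re_le_norm _).trans (ρ.unit_le_opNorm _ hn)
  have h7 : (ρ a).re = (ρ₁ a).re - (ρ₂ a).re := by rw [h]; simp
  rw [map_sub, map_add, Complex.sub_re, Complex.add_re] at h6
  linarith

/-- The supremum `ρ₁` is the least positive functional above `ρ`, so `δ = σ₁ - ρ₁ ≥ 0` and `σᵢ = ρᵢ
+ δ`. Additivity of the norm gives `‖σ₁‖ + ‖σ₂‖ = ‖ρ₁‖ + ‖ρ₂‖ + 2 ‖δ‖`, so `δ = 0`. -/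
theorem IsJordanDecomposition.eq_of_approx {ρ ρ₁ ρ₂ σ₁ σ₂ : B →L[ℂ] ℂ}
    (hρ : IsJordanDecomposition ρ ρ₁ ρ₂)
    (hap : ∀ a, 0 ≤ a → ∀ ε > 0, ∃ b, 0 ≤ b ∧ b ≤ a ∧ (ρ₁ a).re < (ρ b).re + ε)
    (hσ : IsJordanDecomposition ρ σ₁ σ₂) : σ₁ = ρ₁ := by
  have hδ : ∀ x, 0 ≤ x → 0 ≤ (σ₁ - ρ₁) x := by
    intro x hx
    have him : ∀ {φ : B →L[ℂ] ℂ}, (∀ x, 0 ≤ x → 0 ≤ φ x) → (φ x).im = 0 := fun h =>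
      ((Complex.nonneg_iff.1 (h x hx)).2).symm
    rw [sub_apply, Complex.nonneg_iff, Complex.sub_re, Complex.sub_im,
      him hσ.nonneg_left, him hρ.nonneg_left]
    refine ⟨sub_nonneg.2 (le_of_forall_pos_lt_add fun ε hε => ?_), by simp⟩
    obtain ⟨b, hb, hbx, hlt⟩ := hap x hx ε hε
    have e : (ρ b).re = (σ₁ b).re - (σ₂ b).re := by rw [hσ.eq_sub]; simp
    have h1 := (Complex.nonneg_iff.1 (hσ.nonneg_right b hb)).1
    have h2 := (Complex.nonneg_iff.1 (hσ.nonneg_left _ (sub_nonneg.2 hbx))).1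
    rw [map_sub, Complex.sub_re] at h2
    linarith
  have e1 : σ₁ = ρ₁ + (σ₁ - ρ₁) := by abel
  have e2 : σ₂ = ρ₂ + (σ₁ - ρ₁) := by
    have := hσ.eq_sub.symm.trans hρ.eq_sub
    rw [sub_eq_iff_eq_add] at this
    rw [this]; abel
  have n1 := norm_add_of_nonneg hρ.nonneg_left hδ
  have n2 := norm_add_of_nonneg hρ.nonneg_right hδ
  rw [← e1] at n1
  rw [← e2] at n2
  have n3 := hσ.norm_eq
  rw [hρ.norm_eq, n1, n2] at n3
  exact sub_eq_zero.1 (norm_eq_zero.1 (by linarith))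

end JordanDecomposition

/-! ### The Jordan decomposition on `Ped A` and the lattice `TR A`. -/

section Lattice

variable {A : Type u} [NonUnitalCStarAlgebra A] [PartialOrder A] [StarOrderedRing A]

/-- The restriction of a continuous functional on the Pedersen ideal to a C⋆-subalgebra. -/
noncomputable def restrictCLM {τ : Ped A →ₗ[ℂ] ℂ}
    (hτ : @Continuous (Ped A) ℂ (pedTopology A) _ τ) {D : NonUnitalStarSubalgebra ℂ A}
    (hD : IsClosed (D : Set A)) (hDP : D ≤ Ped A) : D →L[ℂ] ℂ :=
  ⟨τ ∘ₗ (NonUnitalStarSubalgebra.inclusion hDP : D →ₗ[ℂ] Ped A),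
    continuous_restrict_of_continuous hτ hD hDP⟩

theorem isRestriction_restrictCLM {τ : Ped A →ₗ[ℂ] ℂ}
    (hτ : @Continuous (Ped A) ℂ (pedTopology A) _ τ) {D : NonUnitalStarSubalgebra ℂ A}
    (hD : IsClosed (D : Set A)) (hDP : D ≤ Ped A) :
    IsRestriction τ hDP (restrictCLM hτ hD hDP) := fun _ => rfl

/-- `φ` is the tracial functional given by the suprema of `τ` over the order intervals `[0, x]`. -/
structure IsPosPart (τ φ : Ped A →ₗ[ℂ] ℂ) : Prop where
  tracial : IsTracial φ
  apply_eq : ∀ x : Ped A, 0 ≤ (x : A) → φ x = (sSup (intervalValues τ (x : A)) : ℝ)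

variable {τ φ : Ped A →ₗ[ℂ] ℂ}

theorem IsPosPart.re_le (h : IsPosPart τ φ) (hτ : τ ∈ TR A) {b x : Ped A} (hb : 0 ≤ (b : A))
    (hbx : (b : A) ≤ x) : (τ b).re ≤ (φ x).re := by
  rw [h.apply_eq x (hb.trans hbx), Complex.ofReal_re]
  exact le_sSup_intervalValues hτ (mem_pedCone_iff.2 ⟨x.2, hb.trans hbx⟩) hb hbx

theorem IsPosPart.exists_lt (h : IsPosPart τ φ) {x : Ped A} (hx : 0 ≤ (x : A)) {ε : ℝ}
    (hε : 0 < ε) : ∃ b : Ped A, 0 ≤ (b : A) ∧ (b : A) ≤ x ∧ (φ x).re < (τ b).re + ε := by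
  rw [h.apply_eq x hx, Complex.ofReal_re]
  obtain ⟨_, ⟨b, hb, hbx, rfl⟩, hlt⟩ := exists_lt_of_lt_csSup
    ⟨0, zero_mem_intervalValues τ hx⟩ (sub_lt_self (sSup (intervalValues τ (x : A))) hε)
  exact ⟨b, hb, hbx, by linarith⟩

theorem IsPosPart.im_eq_zero (h : IsPosPart τ φ) {x : Ped A} (hx : 0 ≤ (x : A)) :
    (φ x).im = 0 := by
  rw [h.apply_eq x hx, Complex.ofReal_im]

theorem IsPosPart.isPositive (h : IsPosPart τ φ) (hτ : τ ∈ TR A) : IsPositive φ := by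
  intro x hx
  have := h.re_le hτ (b := 0) le_rfl hx
  exact Complex.nonneg_iff.2 ⟨by simpa using this, (h.im_eq_zero hx).symm⟩

theorem IsPosPart.isPositive_sub (h : IsPosPart τ φ) (hτ : τ ∈ TR A) : IsPositive (φ - τ) := by
  intro x hx
  rw [LinearMap.sub_apply, Complex.nonneg_iff, Complex.sub_re, Complex.sub_im, h.im_eq_zero hx,
    isSelfAdj_im_eq_zero hτ.2.1 hx.isSelfAdjoint]
  exact ⟨sub_nonneg.2 (h.re_le hτ hx le_rfl), by simp⟩

theorem mem_TR_of_isPositive (hp : IsPositive φ) (ht : IsTracial φ) : φ ∈ TR A :=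
  ⟨continuous_of_isPositive hp, isSelfAdj_of_isPositive hp, ht⟩

theorem IsPosPart.mem_TR (h : IsPosPart τ φ) (hτ : τ ∈ TR A) : φ ∈ TR A :=
  mem_TR_of_isPositive (h.isPositive hτ) h.tracial

/-- For `0 ≤ b ≤ x` one has `τ(b) ≤ σ(b) ≤ σ(x)`; take the supremum over `b`. This is the least
upper bound property behind the lattice structure. -/
theorem IsPosPart.sub_apply_nonneg (h : IsPosPart τ φ) {σ : Ped A →ₗ[ℂ] ℂ} (hσ : IsPositive σ)
    (hστ : IsPositive (σ - τ)) : IsPositive (σ - φ) := by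
  intro x hx
  have hσx := Complex.nonneg_iff.1 (hσ x hx)
  rw [LinearMap.sub_apply, Complex.nonneg_iff, Complex.sub_re, Complex.sub_im, h.im_eq_zero hx,
    ← hσx.2]
  refine ⟨sub_nonneg.2 (le_of_forall_pos_lt_add fun ε hε => ?_), by simp⟩
  obtain ⟨b, hb, hbx, hlt⟩ := h.exists_lt hx hε
  have h1 := (Complex.nonneg_iff.1 (hστ b hb)).1
  have h2 := (Complex.nonneg_iff.1 (hσ (x - b) (sub_nonneg.2 hbx))).1
  rw [LinearMap.sub_apply, Complex.sub_re] at h1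
  rw [map_sub, Complex.sub_re] at h2
  linarith

theorem IsPosPart.restrict_approx (h : IsPosPart τ φ) (hτ : τ ∈ TR A)
    {D : NonUnitalStarSubalgebra ℂ A} (hH : IsHereditary D) (hDP : D ≤ Ped A) :
    ∀ a : D, 0 ≤ a → ∀ ε > 0, ∃ b : D, 0 ≤ b ∧ b ≤ a ∧
      (restrictCLM (h.mem_TR hτ).1 hH.isClosed hDP a).re
        < (restrictCLM hτ.1 hH.isClosed hDP b).re + ε := by
  intro a ha ε hε
  obtain ⟨b, hb, hba, hlt⟩ := h.exists_lt (x := NonUnitalStarSubalgebra.inclusion hDP a) ha hε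
  exact ⟨⟨b, hH.mem_of_le _ _ hb hba a.2⟩, hb, hba, hlt⟩

theorem IsPosPart.restrict_isJordanDecomposition (h : IsPosPart τ φ) (hτ : τ ∈ TR A)
    {D : NonUnitalStarSubalgebra ℂ A} (hH : IsHereditary D) (hDP : D ≤ Ped A) :
    haveI : IsClosed (D : Set A) := hH.isClosed
    IsJordanDecomposition (restrictCLM hτ.1 hH.isClosed hDP)
      (restrictCLM (h.mem_TR hτ).1 hH.isClosed hDP)
      (restrictCLM (sub_mem (h.mem_TR hτ) hτ).1 hH.isClosed hDP) := by
  have : IsClosed (D : Set A) := hH.isClosed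
  have := starOrderedRing_of_isClosed hH.isClosed
  refine isJordanDecomposition_of_approx (fun x hx => h.isPositive hτ _ hx)
    (fun x hx => h.isPositive_sub hτ _ hx) ?_ (h.restrict_approx hτ hH hDP)
  ext x
  change τ _ = φ _ - (φ - τ) _
  simp

theorem IsPosPart.isPedJordanDecomposition (h : IsPosPart τ φ) (hτ : τ ∈ TR A) :
    IsPedJordanDecomposition τ φ (φ - τ) where
  positive_left := h.isPositive hτ
  positive_right := h.isPositive_sub hτ
  tracial_left := h.tracial
  tracial_right := (sub_mem (h.mem_TR hτ) hτ).2.2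
  eq_sub := (sub_sub_cancel φ τ).symm
  restrict _ hH hD := ⟨_, _, _, isRestriction_restrictCLM hτ.1 hH.isClosed hD,
    isRestriction_restrictCLM (h.mem_TR hτ).1 hH.isClosed hD,
    isRestriction_restrictCLM (sub_mem (h.mem_TR hτ) hτ).1 hH.isClosed hD,
    h.restrict_isJordanDecomposition hτ hH hD⟩

/-- Every positive `x` in `Ped A` lies in the hereditary subalgebra `her x ⊆ Ped A`, where bounded
Jordan decompositions are unique. -/
theorem IsPosPart.eq_of_isPedJordanDecomposition (h : IsPosPart τ φ) (hτ : τ ∈ TR A)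
    {τ₁ τ₂ : Ped A →ₗ[ℂ] ℂ} (hJ : IsPedJordanDecomposition τ τ₁ τ₂) : τ₁ = φ := by
  refine linearMap_ext_pedCone fun x hx => ?_
  have hxC : (x : A) ∈ pedCone A := mem_pedCone_iff.2 ⟨x.2, hx⟩
  have hH := isHereditary_her (x : A)
  have : IsClosed (her (x : A) : Set A) := hH.isClosed
  have := starOrderedRing_of_isClosed hH.isClosed
  obtain ⟨ρ, ρ₁, ρ₂, hρ, hρ₁, -, hD⟩ := hJ.restrict _ hH (her_le_Ped hxC)
  have e : ρ = restrictCLM hτ.1 hH.isClosed (her_le_Ped hxC) := by ext y; exact hρ y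
  rw [e] at hD
  have e₁ := (h.restrict_isJordanDecomposition hτ hH (her_le_Ped hxC)).eq_of_approx
    (h.restrict_approx hτ hH (her_le_Ped hxC)) hD
  exact (hρ₁ ⟨x, self_mem_her hx⟩).symm.trans
    (congrArg (fun f => f ⟨(x : A), self_mem_her hx⟩) e₁)

theorem exists_isPosPart (hτ : τ ∈ TR A) : ∃ φ, IsPosPart τ φ :=
  let ⟨φ, h1, h2⟩ := exists_posPart hτ
  ⟨φ, h1, h2⟩

theorem existsUnique_isPedJordanDecomposition (hτ : τ ∈ TR A) :
    ∃! p : (Ped A →ₗ[ℂ] ℂ) × (Ped A →ₗ[ℂ] ℂ), IsPedJordanDecomposition τ p.1 p.2 := by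
  obtain ⟨φ, h⟩ := exists_isPosPart hτ
  refine ⟨(φ, φ - τ), h.isPedJordanDecomposition hτ, fun p hp => ?_⟩
  have h1 := h.eq_of_isPedJordanDecomposition hτ hp
  refine Prod.ext h1 ?_
  have := hp.eq_sub
  rw [h1] at this
  rw [this]
  exact (sub_sub_cancel φ p.2).symm

variable (A) in
/-- The order on `T_ℝ(A)` defined by the cone `T_+(A)`. -/
@[reducible]
def partialOrderTR : PartialOrder (TR A) where
  le σ τ := τ - σ ∈ TPlus A
  le_refl σ x _ := by simp
  le_trans σ τ υ h1 h2 x hx := by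
    have := add_nonneg (h1 x hx) (h2 x hx)
    have e : ((υ - σ : TR A) : Ped A →ₗ[ℂ] ℂ) x
        = ((τ - σ : TR A) : Ped A →ₗ[ℂ] ℂ) x + ((υ - τ : TR A) : Ped A →ₗ[ℂ] ℂ) x := by simp
    rwa [e]
  le_antisymm σ τ h1 h2 := Subtype.ext <| linearMap_ext_pedCone fun x hx => by
    have h1 := h1 x hx
    have h2 := h2 x hx
    simp only [AddSubgroupClass.coe_sub, LinearMap.sub_apply, sub_nonneg] at h1 h2
    exact le_antisymm h1 h2

/-- The positive part of an element of `T_ℝ(A)`. -/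
noncomputable def posPartTR (τ : TR A) : TR A :=
  ⟨(exists_isPosPart τ.2).choose, (exists_isPosPart τ.2).choose_spec.mem_TR τ.2⟩

theorem isPosPart_posPartTR (τ : TR A) : IsPosPart (τ : Ped A →ₗ[ℂ] ℂ) (posPartTR τ) :=
  (exists_isPosPart τ.2).choose_spec

theorem posPartTR_mem (τ : TR A) : posPartTR τ ∈ TPlus A := (isPosPart_posPartTR τ).isPositive τ.2

theorem posPartTR_sub_mem (τ : TR A) : posPartTR τ - τ ∈ TPlus A :=
  (isPosPart_posPartTR τ).isPositive_sub τ.2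

theorem sub_posPartTR_mem {σ τ : TR A} (h1 : σ ∈ TPlus A) (h2 : σ - τ ∈ TPlus A) :
    σ - posPartTR τ ∈ TPlus A := (isPosPart_posPartTR τ).sub_apply_nonneg h1 h2

variable (A) in
/-- The lattice structure on `T_ℝ(A)`. -/
@[reducible]
noncomputable def latticeTR : Lattice (TR A) where
  __ := partialOrderTR A
  sup σ τ := τ + posPartTR (σ - τ)
  inf σ τ := σ - posPartTR (σ - τ)
  le_sup_left σ τ := by
    change τ + posPartTR (σ - τ) - σ ∈ TPlus A
    convert posPartTR_sub_mem (σ - τ) using 1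
    abel
  le_sup_right σ τ := by
    change τ + posPartTR (σ - τ) - τ ∈ TPlus A
    convert posPartTR_mem (σ - τ) using 1
    abel
  sup_le σ τ υ h1 h2 := by
    change υ - (τ + posPartTR (σ - τ)) ∈ TPlus A
    rw [← sub_sub]
    refine sub_posPartTR_mem h2 ?_
    convert! (show υ - σ ∈ TPlus A from h1) using 1
    abel
  inf_le_left σ τ := by
    change σ - (σ - posPartTR (σ - τ)) ∈ TPlus A
    convert posPartTR_mem (σ - τ) using 1
    abel
  inf_le_right σ τ := by
    change τ - (σ - posPartTR (σ - τ)) ∈ TPlus A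
    convert posPartTR_sub_mem (σ - τ) using 1
    abel
  le_inf υ σ τ h1 h2 := by
    change σ - posPartTR (σ - τ) - υ ∈ TPlus A
    rw [sub_right_comm]
    refine sub_posPartTR_mem h1 ?_
    convert! (show τ - υ ∈ TPlus A from h2) using 1
    abel

theorem smul_mem_TPlus {r : ℝ} (hr : 0 ≤ r) {τ : TR A} (h : τ ∈ TPlus A) : r • τ ∈ TPlus A := by
  intro x hx
  have := smul_nonneg hr (h x hx)
  simpa using this

end Lattice

end PedTrace

/-- The first part: every continuous self-adjoint trace on `Ped(A)` has a unique Jordan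
decomposition. The second part: `T_ℝ(A)` with the positive cone `T_+(A)` is a real vector lattice,
and the positive part of the Jordan decomposition of `τ` is `τ ⊔ 0`. -/
theorem corollary3p6 {A : Type*} [NonUnitalCStarAlgebra A] [PartialOrder A]
    [StarOrderedRing A] :
    (∀ τ : PedTrace.TR A,
      ∃! p : (PedTrace.Ped A →ₗ[ℂ] ℂ) × (PedTrace.Ped A →ₗ[ℂ] ℂ),
        PedTrace.IsPedJordanDecomposition (τ : PedTrace.Ped A →ₗ[ℂ] ℂ) p.1 p.2) ∧
    ∃ _L : Lattice (PedTrace.TR A),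
      (∀ σ τ : PedTrace.TR A, σ ≤ τ ↔ τ - σ ∈ PedTrace.TPlus A) ∧
      IsOrderedAddMonoid (PedTrace.TR A) ∧
      IsOrderedModule ℝ (PedTrace.TR A) ∧
      ∀ (τ : PedTrace.TR A) (τ₁ τ₂ : PedTrace.Ped A →ₗ[ℂ] ℂ),
        PedTrace.IsPedJordanDecomposition (τ : PedTrace.Ped A →ₗ[ℂ] ℂ) τ₁ τ₂ →
          ((τ ⊔ 0 : PedTrace.TR A) : PedTrace.Ped A →ₗ[ℂ] ℂ) = τ₁ := by
  refine ⟨fun τ => PedTrace.existsUnique_isPedJordanDecomposition τ.2, PedTrace.latticeTR A,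
    fun σ τ => Iff.rfl, ?_, ?_, fun τ τ₁ τ₂ h => ?_⟩
  · let _ := PedTrace.latticeTR A
    refine { add_le_add_left := fun σ τ h υ => ?_ }
    change τ + υ - (σ + υ) ∈ PedTrace.TPlus A
    rw [add_sub_add_right_eq_sub]
    exact h
  · let _ := PedTrace.latticeTR A
    refine { smul_le_smul_of_nonneg_left := fun r hr σ τ h => ?_,
             smul_le_smul_of_nonneg_right := fun τ hτ r s h => ?_ }
    · change r • τ - r • σ ∈ PedTrace.TPlus A
      have := PedTrace.smul_mem_TPlus hr h
      rwa [smul_sub] at this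
    · change s • τ - r • τ ∈ PedTrace.TPlus A
      have h0 : τ - 0 ∈ PedTrace.TPlus A := hτ
      rw [sub_zero] at h0
      have := PedTrace.smul_mem_TPlus (sub_nonneg.2 h) h0
      have e : (s - r) • τ = s • τ - r • τ := sub_smul s r τ
      rwa [e] at this
  · have e := (PedTrace.isPosPart_posPartTR τ).eq_of_isPedJordanDecomposition τ.2 h
    rw [e]
    change ((0 + PedTrace.posPartTR (τ - 0) : PedTrace.TR A) : PedTrace.Ped A →ₗ[ℂ] ℂ) = _
    rw [zero_add, sub_zero]
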